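/- **Setting.** Let $d\in\mathbb N$, let $Y_1,\dots,Y_d$ be linearly independent vectors in $\mathbb R^d$ generating the lattice $\mathcal R$, and let $\mathcal V\subset\mathbb R^d$ be a unit cell, i.e. a set whose $\mathcal R$-translates fill $\mathbb R^d$ up to null sets and without overlap (up to null sets). Write $\langle f\rangle=\frac1{|\mathcal V|}\int_{\mathcal V}f\,dx$ and $s:e=\sum_{i,j}s_{ij}e_{ij}$. Let $L^2_{\rm per}$ be the space of $\mathcal R$-periodic functions in $L^2_{\rm loc}(\mathbb R^d)$ (up to a.e. equality), and $H^1_{\rm per}$ the space of those $f\in L^2_{\rm per}$ whose weak partial derivatives belong to $L^2_{\rm per}$. Let $L_0=(L_{ijkl})$ be a uniform elasticity tensor: a real fourth-order tensor with the minor and major symmetries, positive definite on symmetric second-order tensors, acting by $(L_0e)_{ij}=\sum_{k,l}L_{ijkl}e_{kl}$; let $L_0^{-1}$ be its inverse on symmetric tensors. Let $H_e$ (resp. $H_s$) be the space of symmetric second-order tensor fields with components in $L^2_{\rm per}$, with the energetic scalar product $(\eta,\eta')\mapsto\langle L_0\eta:\eta'\rangle$ (resp. $(\tau,\tau')\mapsto\langle\tau:L_0^{-1}\tau'\rangle$).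 Let $U_e\subset H_e$ and $U_s\subset H_s$ be the subspaces of uniform (constant) fields and $$E_0=\Big\{\tfrac12(\nabla w+\nabla w^{\top}) : w\in (H^1_{\rm per})^d\Big\}\subset H_e,\qquad S_0=\{s\in H_s : \operatorname{div}s=0,\ \langle s\rangle=0\}\subset H_s,$$ where $\operatorname{div}s=0$ is understood in the sense of distributions on $\mathbb R^d$ for the periodic field $s$ (i.e. $\operatorname{div}s=0$ in $\mathcal V$ with $s\cdot n$ anti-periodic on $\partial\mathcal V$). Put $E=U_e+E_0$ and $S=U_s+S_0$, and let $E^\perp$, $S^\perp$ be their orthogonal complements in $H_e$, $H_s$. The periodic strain Green's operator $\Gamma_0:H_s\to H_e$ maps $\tau$ to the solution $e^*\in E_0$ of $L_0e^*-\tau\in S$; the periodic stress Green's operator $\Delta_0:H_e\to H_s$ maps $\eta$ to the solution $s^*\in S_0$ of $L_0^{-1}s^*-\eta\in E$. **Proposition.** $H_e$ and $H_s$ are Hilbert spaces, and for every $\tau\in H_s$ (resp. $\eta\in H_e$) the problem defining $\Gamma_0\tau$ (resp. $\Delta_0\eta$) has exactly one solution. Moreover: 1. In $H_e$, the subspaces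 $U_e$ and $E_0$ are orthogonal, the orthogonal projectors onto $U_e$, $E_0$ and $E^\perp$ exist and are given by $$P_{U_e}=\langle\cdot\rangle,\qquad P_{E_0}=\Gamma_0L_0,\qquad P_{E^\perp}=L_0^{-1}\Delta_0,$$ and $\eta=\langle\eta\rangle+P_{E_0}\eta+P_{E^\perp}\eta=\langle\eta\rangle+\Gamma_0L_0\eta+L_0^{-1}\Delta_0\eta$ for all $\eta\in H_e$. 2. In $H_s$, the subspaces $U_s$ and $S_0$ are orthogonal, the orthogonal projectors onto $U_s$, $S_0$ and $S^\perp$ exist and are given by $$P_{U_s}=\langle\cdot\rangle,\qquad P_{S_0}=\Delta_0L_0^{-1},\qquad P_{S^\perp}=L_0\Gamma_0,$$ and $\tau=\langle\tau\rangle+P_{S_0}\tau+P_{S^\perp}\tau=\langle\tau\rangle+\Delta_0L_0^{-1}\tau+L_0\Gamma_0\tau$ for all $\tau\in H_s$. -/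

import Mathlib

open MeasureTheory Module
open scoped ContDiff

/-! ### Second-order tensors and elasticity tensors -/

/-- Second-order tensors on `ℝ^d`, given by their components. -/
abbrev Tensor2 (d : ℕ) : Type := Fin d → Fin d → ℝ

/-- The doubly contracted product `s : e = ∑ s_ij e_ij`. -/
def dcontr {d : ℕ} (s e : Tensor2 d) : ℝ := ∑ i, ∑ j, s i j * e i j

/-- A uniform elasticity tensor: a fourth-order tensor with minor and major symmetries which is
positive definite on symmetric second-order tensors. -/
structure ElasticityTensor (d : ℕ) where
  coeff : Fin d → Fin d → Fin d → Fin d → ℝ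
  minor_left : ∀ i j k l, coeff i j k l = coeff j i k l
  minor_right : ∀ i j k l, coeff i j k l = coeff i j l k
  major : ∀ i j k l, coeff i j k l = coeff k l i j
  pos : ∀ e : Tensor2 d, (∀ i j, e i j = e j i) → e ≠ 0 →
    0 < dcontr (fun i j => ∑ k, ∑ l, coeff i j k l * e k l) e

namespace ElasticityTensor

variable {d : ℕ}

/-- The action `(L e)_ij = ∑ L_ijkl e_kl` on second-order tensors. -/
def act (L : ElasticityTensor d) (e : Tensor2 d) : Tensor2 d :=
  fun i j => ∑ k, ∑ l, L.coeff i j k l * e k l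

/-- Symmetric second-order tensors. -/
def symTensors (d : ℕ) : Submodule ℝ (Tensor2 d) where
  carrier := {e | ∀ i j, e i j = e j i}
  add_mem' := fun ha hb i j => by simp [ha i j, hb i j]
  zero_mem' := fun _ _ => rfl
  smul_mem' := fun c _ ha i j => by simp [ha i j]

/-- The action of an elasticity tensor on symmetric tensors, as a linear map. -/
def symMap (L : ElasticityTensor d) : symTensors d →ₗ[ℝ] symTensors d where
  toFun e := ⟨L.act e.1, fun i j => by simp only [act, L.minor_left i j]⟩
  map_add' a b := by
    ext i j
    simp [act, mul_add, Finset.sum_add_distrib]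
  map_smul' c a := by
    ext i j
    simp only [act, Submodule.coe_smul, Pi.smul_apply, smul_eq_mul, RingHom.id_apply,
      Finset.mul_sum]
    exact Finset.sum_congr rfl fun _ _ => Finset.sum_congr rfl fun _ _ => by ring

theorem symMap_injective (L : ElasticityTensor d) : Function.Injective L.symMap := by
  rw [injective_iff_map_eq_zero]
  intro e he
  by_contra hne
  have h := L.pos e.1 e.2 (fun h0 => hne (Subtype.ext h0))
  have h2 : L.act e.1 = 0 := congrArg Subtype.val he
  change 0 < dcontr (L.act e.1) e.1 at h
  simp [h2, dcontr] at h

/-- An elasticity tensor acts invertibly on symmetric tensors. -/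
noncomputable def symEquiv (L : ElasticityTensor d) : symTensors d ≃ₗ[ℝ] symTensors d :=
  LinearEquiv.ofInjectiveEndo L.symMap L.symMap_injective

theorem act_symEquiv_symm (L : ElasticityTensor d) (e : symTensors d) :
    L.act (L.symEquiv.symm e).1 = e.1 := by
  have h : L.symMap (L.symEquiv.symm e) = e := L.symEquiv.apply_symm_apply e
  exact congrArg Subtype.val h

/-- The symmetrized unit tensor `(e_k ⊗ e_l + e_l ⊗ e_k) / 2`. -/
noncomputable def symUnit (k l : Fin d) : symTensors d :=
  ⟨fun i j => ((if i = k ∧ j = l then 1 else 0) + (if i = l ∧ j = k then 1 else 0)) / 2,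
    fun i j => by
      simp only [and_comm (a := i = k), and_comm (a := i = l)]
      rw [add_comm]⟩

theorem symUnit_comm (k l : Fin d) : symUnit k l = symUnit l k := by
  ext i j
  simp only [symUnit]
  rw [add_comm]

theorem dcontr_symUnit (k l : Fin d) (e : symTensors d) :
    dcontr (symUnit k l).1 e.1 = e.1 k l := by
  have h : e.1 l k = e.1 k l := e.2 l k
  simp only [dcontr, symUnit, add_div, add_mul, Finset.sum_add_distrib, ite_and, ite_div, ite_mul,
    zero_div, zero_mul, Finset.sum_ite_eq', Finset.sum_ite_irrel, Finset.sum_const_zero,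
    Finset.mem_univ, if_true]
  rw [h]; ring

theorem sum_smul_symUnit (e : symTensors d) : ∑ k, ∑ l, e.1 k l • symUnit k l = e := by
  ext i j
  have h : e.1 j i = e.1 i j := e.2 j i
  simp only [AddSubmonoidClass.coe_finsetSum, Finset.sum_apply, Submodule.coe_smul,
    Pi.smul_apply, smul_eq_mul, symUnit, add_div, mul_add, Finset.sum_add_distrib, ite_and,
    ite_div, mul_ite, zero_div, mul_zero, Finset.sum_ite_eq, Finset.sum_ite_irrel,
    Finset.sum_const_zero, Finset.mem_univ, if_true]
  rw [h]; ring

theorem dcontr_comm (s e : Tensor2 d) : dcontr s e = dcontr e s := by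
  simp only [dcontr, mul_comm]

theorem dcontr_act_comm (L : ElasticityTensor d) (s e : Tensor2 d) :
    dcontr (L.act s) e = dcontr (L.act e) s := by
  simp only [dcontr, act, Finset.sum_mul]
  calc ∑ i, ∑ j, ∑ k, ∑ l, L.coeff i j k l * s k l * e i j
      = ∑ p : Fin d × Fin d, ∑ q : Fin d × Fin d,
          L.coeff p.1 p.2 q.1 q.2 * s q.1 q.2 * e p.1 p.2 := by
        simp only [Fintype.sum_prod_type]
    _ = ∑ q : Fin d × Fin d, ∑ p : Fin d × Fin d,
          L.coeff q.1 q.2 p.1 p.2 * e p.1 p.2 * s q.1 q.2 := by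
        rw [Finset.sum_comm]
        refine Finset.sum_congr rfl fun q _ => Finset.sum_congr rfl fun p _ => ?_
        rw [L.major]; ring
    _ = _ := by simp only [Fintype.sum_prod_type]

theorem dcontr_symm_comm (L : ElasticityTensor d) (a b : symTensors d) :
    dcontr a.1 (L.symEquiv.symm b).1 = dcontr b.1 (L.symEquiv.symm a).1 := by
  conv_lhs => rw [← L.act_symEquiv_symm a]
  rw [dcontr_act_comm, L.act_symEquiv_symm]

theorem sum_symm_symUnit (L : ElasticityTensor d) (e : symTensors d) :
    (fun i j => ∑ k, ∑ l, (L.symEquiv.symm (symUnit k l)).1 i j * e.1 k l) =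
      (L.symEquiv.symm e).1 := by
  conv_rhs => rw [← sum_smul_symUnit e]
  ext i j
  simp only [map_sum, map_smul, AddSubmonoidClass.coe_finsetSum, Finset.sum_apply,
    Submodule.coe_smul, Pi.smul_apply, smul_eq_mul]
  exact Finset.sum_congr rfl fun _ _ => Finset.sum_congr rfl fun _ _ => mul_comm _ _

/-- The inverse `L⁻¹` (the compliance tensor) of an elasticity tensor: the fourth-order tensor
with minor and major symmetries that inverts the action of `L` on symmetric tensors. -/
noncomputable def inv (L : ElasticityTensor d) : ElasticityTensor d where
  coeff i j k l := (L.symEquiv.symm (symUnit k l)).1 i j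
  minor_left i j k l := (L.symEquiv.symm (symUnit k l)).2 i j
  minor_right i j k l := by rw [symUnit_comm]
  major i j k l := by
    rw [← dcontr_symUnit, ← dcontr_symUnit, dcontr_symm_comm]
  pos e he hne := by
    have h := L.sum_symm_symUnit ⟨e, he⟩
    simp only at h
    rw [h]
    set f := L.symEquiv.symm ⟨e, he⟩ with hf
    have h1 : L.act f.1 = e := L.act_symEquiv_symm ⟨e, he⟩
    have h2 := L.pos f.1 f.2 (fun h0 => hne (by rw [← h1, h0]; ext i j; simp [act]))
    change 0 < dcontr (L.act f.1) f.1 at h2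
    rwa [h1, dcontr_comm] at h2

theorem act_inv_act (L : ElasticityTensor d) (e : Tensor2 d) (he : ∀ i j, e i j = e j i) :
    L.act (L.inv.act e) = e := by
  have h : L.inv.act e = (L.symEquiv.symm ⟨e, he⟩).1 := L.sum_symm_symUnit ⟨e, he⟩
  rw [h, L.act_symEquiv_symm]

theorem inv_act_act (L : ElasticityTensor d) (e : Tensor2 d) (he : ∀ i j, e i j = e j i) :
    L.inv.act (L.act e) = e := by
  have h : L.inv.act (L.symMap ⟨e, he⟩).1 = (L.symEquiv.symm (L.symMap ⟨e, he⟩)).1 :=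
    L.sum_symm_symUnit _
  have h2 : L.symEquiv.symm (L.symMap ⟨e, he⟩) = ⟨e, he⟩ :=
    L.symEquiv.symm_apply_apply ⟨e, he⟩
  rw [h2] at h
  exact h

end ElasticityTensor

/-! ### Periodic scalar fields -/

/-- A unit cell of `ℝ^d`: `d` linearly independent vectors, and a set whose translates by the
lattice that these vectors generate fill the space (up to null sets, without overlap). -/
structure PeriodicCell (d : ℕ) where
  vec : Basis (Fin d) ℝ (EuclideanSpace ℝ (Fin d))
  cell : Set (EuclideanSpace ℝ (Fin d))
  tiles : IsAddFundamentalDomain (Submodule.span ℤ (Set.range vec)).toAddSubgroup cell volume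

namespace PeriodicCell

variable {d : ℕ} (C : PeriodicCell d)

/-- The lattice of periods. -/
def lattice : AddSubgroup (EuclideanSpace ℝ (Fin d)) :=
  (Submodule.span ℤ (Set.range C.vec)).toAddSubgroup

/-- `L²_per`: (classes of) locally square-integrable functions on `ℝ^d` that are periodic. -/
def L2per : Submodule ℝ (EuclideanSpace ℝ (Fin d) →ₘ[volume] ℝ) where
  carrier := {f | LocallyIntegrable (fun x => f x ^ 2) volume ∧
    ∀ Y ∈ C.lattice, ∀ᵐ x ∂volume, f (x + Y) = f x}
  add_mem' := by
    rintro f g ⟨hf, hf'⟩ ⟨hg, hg'⟩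
    refine ⟨?_, fun Y hY => ?_⟩
    · have h : LocallyIntegrable (fun x => 2 * f x ^ 2 + 2 * g x ^ 2) volume :=
        (hf.smul (2 : ℝ)).add (hg.smul (2 : ℝ))
      refine h.mono ((f + g).aestronglyMeasurable.pow 2) ?_
      filter_upwards [AEEqFun.coeFn_add f g] with x hx
      rw [hx, Pi.add_apply, Real.norm_of_nonneg (by positivity), Real.norm_of_nonneg (by positivity)]
      nlinarith [sq_nonneg (f x - g x)]
    · have h := (measurePreserving_add_right volume Y).quasiMeasurePreserving.ae
        (AEEqFun.coeFn_add f g)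
      filter_upwards [AEEqFun.coeFn_add f g, h, hf' Y hY, hg' Y hY] with x h1 h2 h3 h4
      rw [h1, h2, Pi.add_apply, Pi.add_apply, h3, h4]
  zero_mem' := by
    have h0 : ((0 : EuclideanSpace ℝ (Fin d) →ₘ[volume] ℝ) : EuclideanSpace ℝ (Fin d) → ℝ)
        =ᵐ[volume] 0 := AEEqFun.coeFn_zero
    refine ⟨?_, fun Y hY => ?_⟩
    · refine (locallyIntegrable_const (0 : ℝ)).mono (AEEqFun.aestronglyMeasurable _ |>.pow 2) ?_
      filter_upwards [h0] with x hx
      simp [hx]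
    · have h := (measurePreserving_add_right volume Y).quasiMeasurePreserving.ae h0
      filter_upwards [h0, h] with x h1 h2
      rw [h1, h2]; rfl
  smul_mem' := by
    rintro c f ⟨hf, hf'⟩
    refine ⟨?_, fun Y hY => ?_⟩
    · refine (hf.smul (c ^ 2)).mono ((c • f).aestronglyMeasurable.pow 2) ?_
      filter_upwards [AEEqFun.coeFn_smul c f] with x hx
      simp [hx, mul_pow]
    · have h := (measurePreserving_add_right volume Y).quasiMeasurePreserving.ae
        (AEEqFun.coeFn_smul c f)
      filter_upwards [AEEqFun.coeFn_smul c f, h, hf' Y hY] with x h1 h2 h3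
      rw [h1, h2, Pi.smul_apply, Pi.smul_apply, h3]

/-- The constant function `c`, as an element of `L²_per`. -/
noncomputable def constField (c : ℝ) : C.L2per :=
  ⟨AEEqFun.const _ c, by
    have h0 := AEEqFun.coeFn_const (μ := (volume : Measure (EuclideanSpace ℝ (Fin d)))) _ c
    refine ⟨?_, fun Y hY => ?_⟩
    · refine (locallyIntegrable_const (c ^ 2)).mono (AEEqFun.aestronglyMeasurable _ |>.pow 2) ?_
      filter_upwards [h0] with x hx
      simp [hx]
    · have h := (measurePreserving_add_right volume Y).quasiMeasurePreserving.ae h0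
      filter_upwards [h0, h] with x h1 h2
      rw [h1, h2]; rfl⟩

/-- `g` is the weak (distributional) partial derivative `∂_j f` on `ℝ^d`. -/
def IsWeakPartial (j : Fin d) (f g : C.L2per) : Prop :=
  ∀ φ : EuclideanSpace ℝ (Fin d) → ℝ, ContDiff ℝ ∞ φ → HasCompactSupport φ →
    ∫ x, f.1 x * fderiv ℝ φ x (EuclideanSpace.single j 1) = - ∫ x, g.1 x * φ x

/-- `G` is the weak gradient, `G_ij = ∂_j w_i`, of the periodic vector field `w`; that some such
`G` with entries in `L²_per` exists means that `w` belongs to `H¹_per`. -/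
def IsWeakGradient (w : Fin d → C.L2per) (G : Fin d → Fin d → C.L2per) : Prop :=
  ∀ i j, C.IsWeakPartial j (w i) (G i j)

/-! ### Square integrability over the cell -/

instance : Countable C.lattice :=
  inferInstanceAs (Countable (Submodule.span ℤ (Set.range C.vec)))

theorem tiles' : IsAddFundamentalDomain C.lattice C.cell volume := C.tiles

theorem setLIntegral_eq_of_periodic {S T : Set (EuclideanSpace ℝ (Fin d))}
    (hS : IsAddFundamentalDomain C.lattice S volume)
    (hT : IsAddFundamentalDomain C.lattice T volume)
    (f : EuclideanSpace ℝ (Fin d) → ENNReal)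
    (hf : ∀ Y ∈ C.lattice, ∀ᵐ x ∂volume, f (x + Y) = f x) :
    ∫⁻ x in S, f x = ∫⁻ x in T, f x := by
  rw [hT.setLIntegral_eq_tsum f S, hS.setLIntegral_eq_tsum' f T]
  refine tsum_congr fun g => ?_
  rw [Set.inter_comm]
  refine lintegral_congr_ae (ae_restrict_of_ae ?_)
  filter_upwards [hf (-g.1) (neg_mem g.2)] with x hx
  rw [← hx, add_comm]
  rfl

theorem memLp_cell (f : C.L2per) : MemLp f.1 2 (volume.restrict C.cell) := by
  have hP : IsAddFundamentalDomain C.lattice (ZSpan.fundamentalDomain C.vec) volume :=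
    ZSpan.isAddFundamentalDomain' C.vec volume
  have hm : AEStronglyMeasurable f.1 (volume.restrict C.cell) :=
    f.1.aestronglyMeasurable.restrict
  rw [memLp_two_iff_integrable_sq hm]
  refine ⟨hm.pow 2, ?_⟩
  rw [hasFiniteIntegral_iff_enorm, C.setLIntegral_eq_of_periodic C.tiles' hP]
  · have h : IntegrableOn (fun x => f.1 x ^ 2) (closure (ZSpan.fundamentalDomain C.vec)) :=
      f.2.1.integrableOn_isCompact
        (ZSpan.fundamentalDomain_isBounded C.vec).isCompact_closure
    exact (h.mono_set subset_closure).2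
  · intro Y hY
    filter_upwards [f.2.2 Y hY] with x hx
    rw [hx]

theorem integrable_mul_cell (f g : C.L2per) :
    Integrable (fun x => f.1 x * g.1 x) (volume.restrict C.cell) :=
  (C.memLp_cell f).integrable_mul (C.memLp_cell g)

theorem eq_zero_of_cell (f : C.L2per) (h : ∀ᵐ x ∂volume.restrict C.cell, f.1 x = 0) : f = 0 := by
  have hP := C.tiles'
  rw [ae_restrict_iff'₀ hP.nullMeasurableSet] at h
  have h1 : ∀ᵐ x ∂volume, ∀ g : C.lattice, x + g.1 ∈ C.cell → f.1 (x + g.1) = 0 :=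
    ae_all_iff.2 fun g =>
      (measurePreserving_add_right volume g.1).quasiMeasurePreserving.ae h
  have h2 : ∀ᵐ x ∂volume, ∀ g : C.lattice, f.1 (x + g.1) = f.1 x :=
    ae_all_iff.2 fun g => f.2.2 g.1 g.2
  refine Subtype.ext (AEEqFun.ext ?_)
  have h0 : (((0 : C.L2per) : EuclideanSpace ℝ (Fin d) →ₘ[volume] ℝ) :
      EuclideanSpace ℝ (Fin d) → ℝ) =ᵐ[volume] 0 := AEEqFun.coeFn_zero
  filter_upwards [h1, h2, h0, hP.ae_covers] with x h1 h2 h0 ⟨g, hg⟩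
  have hg' : x + g.1 ∈ C.cell := by rw [add_comm]; exact hg
  rw [h0, ← h2 g, h1 g hg']; rfl

theorem volume_cell : volume C.cell ≠ 0 ∧ volume C.cell ≠ ⊤ := by
  have hP : IsAddFundamentalDomain C.lattice (ZSpan.fundamentalDomain C.vec) volume :=
    ZSpan.isAddFundamentalDomain' C.vec volume
  rw [C.tiles'.measure_eq hP]
  exact ⟨ZSpan.measure_fundamentalDomain_ne_zero C.vec,
    (ZSpan.fundamentalDomain_isBounded C.vec).measure_lt_top.ne⟩

/-! ### Symmetric tensor fields and their energetic Hilbert space structure -/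

/-- Symmetric second-order tensor fields with components in `L²_per`. -/
def tensorFields : Submodule ℝ (Fin d → Fin d → C.L2per) where
  carrier := {F | ∀ i j, F i j = F j i}
  add_mem' := fun ha hb i j => by simp [ha i j, hb i j]
  zero_mem' := fun _ _ => rfl
  smul_mem' := fun c _ ha i j => by simp [ha i j]

/-- The space of symmetric `L²_per`-tensor fields, to be equipped with the energetic scalar product
`⟨M η : η'⟩` of an elasticity tensor `M`. -/
def EnergySpace (_M : ElasticityTensor d) : Type := C.tensorFields

variable {C}

namespace EnergySpace

variable {M : ElasticityTensor d}

noncomputable instance : AddCommGroup (C.EnergySpace M) :=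
  inferInstanceAs (AddCommGroup C.tensorFields)

noncomputable instance : Module ℝ (C.EnergySpace M) :=
  inferInstanceAs (Module ℝ C.tensorFields)

/-- The component `η_ij`, an element of `L²_per`. -/
def comp (η : C.EnergySpace M) (i j : Fin d) : C.L2per := η.1 i j

/-- The value `η(x)` (of the chosen representative). -/
noncomputable def val (η : C.EnergySpace M) (x : EuclideanSpace ℝ (Fin d)) : Tensor2 d :=
  fun i j => (η.comp i j).1 x

@[ext]
theorem ext {η θ : C.EnergySpace M} (h : ∀ i j, η.comp i j = θ.comp i j) : η = θ :=
  Subtype.ext (funext fun i => funext fun j => h i j)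

theorem comp_symm (η : C.EnergySpace M) (i j : Fin d) : η.comp i j = η.comp j i := η.2 i j

theorem comp_add (η θ : C.EnergySpace M) (i j : Fin d) :
    (η + θ).comp i j = η.comp i j + θ.comp i j := rfl

theorem comp_smul (c : ℝ) (η : C.EnergySpace M) (i j : Fin d) :
    (c • η).comp i j = c • η.comp i j := rfl

theorem comp_zero (i j : Fin d) : (0 : C.EnergySpace M).comp i j = 0 := rfl

theorem val_symm (η : C.EnergySpace M) (x : EuclideanSpace ℝ (Fin d)) (i j : Fin d) :
    η.val x i j = η.val x j i := by
  simp only [val, η.comp_symm i j]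

theorem val_add (η θ : C.EnergySpace M) :
    ∀ᵐ x ∂volume, (η + θ).val x = η.val x + θ.val x := by
  have h : ∀ᵐ x ∂volume, ∀ i j, (η + θ).val x i j = η.val x i j + θ.val x i j :=
    ae_all_iff.2 fun i => ae_all_iff.2 fun j =>
      AEEqFun.coeFn_add (η.comp i j).1 (θ.comp i j).1
  filter_upwards [h] with x hx
  ext i j
  exact hx i j

theorem val_smul (c : ℝ) (η : C.EnergySpace M) :
    ∀ᵐ x ∂volume, (c • η).val x = c • η.val x := by
  have h : ∀ᵐ x ∂volume, ∀ i j, (c • η).val x i j = c * η.val x i j :=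
    ae_all_iff.2 fun i => ae_all_iff.2 fun j => AEEqFun.coeFn_smul c (η.comp i j).1
  filter_upwards [h] with x hx
  ext i j
  exact hx i j

/-- The energetic scalar product `⟨M η : θ⟩`, where `⟨·⟩` is the average over the cell. -/
noncomputable def energyInner (η θ : C.EnergySpace M) : ℝ :=
  ⨍ x in C.cell, dcontr (M.act (η.val x)) (θ.val x)

theorem integrable_energy (η θ : C.EnergySpace M) :
    Integrable (fun x => dcontr (M.act (η.val x)) (θ.val x)) (volume.restrict C.cell) := by
  simp only [dcontr, ElasticityTensor.act, Finset.sum_mul]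
  refine integrable_finsetSum _ fun i _ => integrable_finsetSum _ fun j _ =>
    integrable_finsetSum _ fun k _ => integrable_finsetSum _ fun l _ => ?_
  simp only [mul_assoc]
  exact (C.integrable_mul_cell (η.comp k l) (θ.comp i j)).const_mul _

theorem act_nonneg (M : ElasticityTensor d) (e : Tensor2 d) (he : ∀ i j, e i j = e j i) :
    0 ≤ dcontr (M.act e) e := by
  by_cases h : e = 0
  · subst h; simp [dcontr]
  · exact (M.pos e he h).le

@[reducible]
noncomputable def innerCore (C : PeriodicCell d) (M : ElasticityTensor d) :
    InnerProductSpace.Core ℝ (C.EnergySpace M) where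
  inner := energyInner
  conj_inner_symm η θ := by
    simp only [conj_trivial, energyInner]
    congr 1
    ext x
    exact M.dcontr_act_comm _ _
  re_inner_nonneg η := by
    simp only [RCLike.re_to_real, energyInner]
    rw [setAverage_eq]
    exact smul_nonneg (by positivity)
      (integral_nonneg fun x => act_nonneg M _ (η.val_symm x))
  add_left η θ ζ := by
    simp only [energyInner]
    rw [setAverage_eq, setAverage_eq, setAverage_eq, ← smul_add,
      ← integral_add (integrable_energy η ζ) (integrable_energy θ ζ)]
    refine congrArg (fun t : ℝ => (volume.real C.cell)⁻¹ • t) ?_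
    refine integral_congr_ae (ae_restrict_of_ae ?_)
    filter_upwards [val_add η θ] with x hx
    simp only [hx, dcontr, ElasticityTensor.act, Pi.add_apply, mul_add, add_mul,
      Finset.sum_add_distrib]
  smul_left η θ c := by
    simp only [energyInner, conj_trivial]
    rw [setAverage_eq, setAverage_eq, smul_eq_mul, smul_eq_mul, mul_left_comm,
      ← integral_const_mul c]
    refine congrArg (fun t : ℝ => (volume.real C.cell)⁻¹ * t) ?_
    refine integral_congr_ae (ae_restrict_of_ae ?_)
    filter_upwards [val_smul c η] with x hx
    simp only [hx, dcontr, ElasticityTensor.act, Pi.smul_apply, smul_eq_mul, Finset.mul_sum,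
      Finset.sum_mul]
    refine Finset.sum_congr rfl fun _ _ => Finset.sum_congr rfl fun _ _ =>
      Finset.sum_congr rfl fun _ _ => Finset.sum_congr rfl fun _ _ => by ring
  definite η h := by
    simp only [energyInner] at h
    rw [setAverage_eq, smul_eq_zero] at h
    have hv : volume.real C.cell ≠ 0 :=
      (ENNReal.toReal_ne_zero).2 C.volume_cell
    have h1 := h.resolve_left (inv_ne_zero hv)
    rw [integral_eq_zero_iff_of_nonneg (fun x => act_nonneg M _ (η.val_symm x))
      (integrable_energy η η)] at h1
    ext1 i j
    refine C.eq_zero_of_cell _ ?_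
    filter_upwards [h1] with x hx
    by_contra hne
    have h0 : η.val x ≠ 0 := fun h0 => hne (congrFun (congrFun h0 i) j)
    exact absurd hx (M.pos _ (η.val_symm x) h0).ne'

noncomputable instance : NormedAddCommGroup (C.EnergySpace M) :=
  (innerCore C M).toNormedAddCommGroup

noncomputable instance : InnerProductSpace ℝ (C.EnergySpace M) :=
  InnerProductSpace.ofCore (innerCore C M).toCore

theorem inner_def (η θ : C.EnergySpace M) :
    inner ℝ η θ = ⨍ x in C.cell, dcontr (M.act (η.val x)) (θ.val x) := rfl

/-- The pointwise action of an elasticity tensor `K` on fields,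
`(K η)_ij = ∑ K_ijkl η_kl`. -/
noncomputable def applyTensor (K : ElasticityTensor d) {M' : ElasticityTensor d}
    (η : C.EnergySpace M) : C.EnergySpace M' :=
  ⟨fun i j => ∑ k, ∑ l, K.coeff i j k l • η.comp k l,
    fun i j => by simp only [K.minor_left i j]⟩

/-- The uniform field with value the symmetric tensor `A`. -/
noncomputable def const (A : Tensor2 d) (hA : ∀ i j, A i j = A j i) : C.EnergySpace M :=
  ⟨fun i j => C.constField (A i j), fun i j => congrArg C.constField (hA i j)⟩

/-- The average `⟨η⟩` over the cell, as a uniform field. -/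
noncomputable def mean (η : C.EnergySpace M) : C.EnergySpace M :=
  const (fun i j => ⨍ x in C.cell, η.val x i j) fun i j => by simp only [η.val_symm _ i j]

end EnergySpace

variable (C)

/-! ### Admissible fields -/

/-- `𝐔`: the uniform fields. -/
def uniformFields (M : ElasticityTensor d) : Submodule ℝ (C.EnergySpace M) where
  carrier := {η | ∃ (A : Tensor2 d) (hA : ∀ i j, A i j = A j i), η = EnergySpace.const A hA}
  add_mem' := by
    rintro _ _ ⟨A, hA, rfl⟩ ⟨B, hB, rfl⟩
    exact ⟨A + B, fun i j => by simp [hA i j, hB i j], rfl⟩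
  zero_mem' := ⟨0, fun _ _ => rfl, rfl⟩
  smul_mem' := by
    rintro c _ ⟨A, hA, rfl⟩
    exact ⟨c • A, fun i j => by simp [hA i j], rfl⟩

variable {C} in
theorem integrable_test {f : C.L2per} {φ : EuclideanSpace ℝ (Fin d) → ℝ} (hφ : Continuous φ)
    (hc : HasCompactSupport φ) : Integrable (fun x => f.1 x * φ x) := by
  have hloc : LocallyIntegrable (fun x => f.1 x) volume := by
    refine ((locallyIntegrable_const (1 : ℝ)).add f.2.1).mono f.1.aestronglyMeasurable ?_
    refine Filter.Eventually.of_forall fun x => ?_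
    rw [Pi.add_apply, Real.norm_of_nonneg (by positivity : (0 : ℝ) ≤ 1 + f.1 x ^ 2),
      Real.norm_eq_abs]
    nlinarith [sq_nonneg (|f.1 x| - 1), sq_abs (f.1 x)]
  simpa [mul_comm] using hloc.integrable_smul_right_of_hasCompactSupport hφ hc

variable {C} in
theorem integrable_test_deriv {f : C.L2per} {φ : EuclideanSpace ℝ (Fin d) → ℝ}
    (hφ : ContDiff ℝ ∞ φ) (hc : HasCompactSupport φ) (v : EuclideanSpace ℝ (Fin d)) :
    Integrable (fun x => f.1 x * fderiv ℝ φ x v) :=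
  integrable_test (hφ.continuous_fderiv_apply (by simp) |>.comp (by fun_prop : Continuous fun x => (x, v)))
    (hc.fderiv_apply ℝ v)

theorem IsWeakPartial.add {j : Fin d} {f g f' g' : C.L2per} (h : C.IsWeakPartial j f g)
    (h' : C.IsWeakPartial j f' g') : C.IsWeakPartial j (f + f') (g + g') := by
  intro φ hφ hc
  have e1 : ∫ x, (f + f').1 x * fderiv ℝ φ x (EuclideanSpace.single j 1) =
      ∫ x, (f.1 x * fderiv ℝ φ x (EuclideanSpace.single j 1) +
        f'.1 x * fderiv ℝ φ x (EuclideanSpace.single j 1)) := by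
    refine integral_congr_ae ?_
    filter_upwards [AEEqFun.coeFn_add f.1 f'.1] with x hx
    rw [← add_mul]; congr 1
  have e2 : ∫ x, (g + g').1 x * φ x = ∫ x, (g.1 x * φ x + g'.1 x * φ x) := by
    refine integral_congr_ae ?_
    filter_upwards [AEEqFun.coeFn_add g.1 g'.1] with x hx
    rw [← add_mul]; congr 1
  rw [e1, e2, integral_add (integrable_test_deriv hφ hc _) (integrable_test_deriv hφ hc _),
    integral_add (integrable_test hφ.continuous hc) (integrable_test hφ.continuous hc),
    h φ hφ hc, h' φ hφ hc]
  ring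

theorem IsWeakPartial.smul {j : Fin d} {f g : C.L2per} (c : ℝ) (h : C.IsWeakPartial j f g) :
    C.IsWeakPartial j (c • f) (c • g) := by
  intro φ hφ hc
  have e1 : ∫ x, (c • f).1 x * fderiv ℝ φ x (EuclideanSpace.single j 1) =
      ∫ x, c * (f.1 x * fderiv ℝ φ x (EuclideanSpace.single j 1)) := by
    refine integral_congr_ae ?_
    filter_upwards [AEEqFun.coeFn_smul c f.1] with x hx
    rw [← mul_assoc]; congr 1
  have e2 : ∫ x, (c • g).1 x * φ x = ∫ x, c * (g.1 x * φ x) := by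
    refine integral_congr_ae ?_
    filter_upwards [AEEqFun.coeFn_smul c g.1] with x hx
    rw [← mul_assoc]; congr 1
  rw [e1, e2, integral_const_mul, integral_const_mul, h φ hφ hc]
  ring

theorem IsWeakPartial.zero (j : Fin d) : C.IsWeakPartial j 0 0 := by
  intro φ _ _
  have h0 : (((0 : C.L2per) : EuclideanSpace ℝ (Fin d) →ₘ[volume] ℝ) :
      EuclideanSpace ℝ (Fin d) → ℝ) =ᵐ[volume] 0 := AEEqFun.coeFn_zero
  rw [integral_eq_zero_of_ae, integral_eq_zero_of_ae, neg_zero]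
  all_goals
    filter_upwards [h0] with x hx
    rw [hx]; simp

/-- `𝐄₀`: the compatible fields, i.e. the symmetrized gradients `(∇w + ∇wᵀ)/2` of periodic
displacement fields `w ∈ H¹_per`. -/
noncomputable def compatibleFields (M : ElasticityTensor d) : Submodule ℝ (C.EnergySpace M) where
  carrier := {e | ∃ (w : Fin d → C.L2per) (G : Fin d → Fin d → C.L2per), C.IsWeakGradient w G ∧
    ∀ i j, e.comp i j = (1 / 2 : ℝ) • (G i j + G j i)}
  add_mem' := by
    rintro a b ⟨w, G, hw, ha⟩ ⟨w', G', hw', hb⟩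
    refine ⟨w + w', G + G', fun i j => (hw i j).add C (hw' i j), fun i j => ?_⟩
    rw [EnergySpace.comp_add, ha, hb, ← smul_add]
    simp only [Pi.add_apply]
    congr 1
    abel
  zero_mem' := ⟨0, 0, fun i j => IsWeakPartial.zero C j, fun i j => by
    simp [EnergySpace.comp_zero]⟩
  smul_mem' := by
    rintro c a ⟨w, G, hw, ha⟩
    refine ⟨c • w, c • G, fun i j => (hw i j).smul C c, fun i j => ?_⟩
    rw [EnergySpace.comp_smul, ha, smul_comm]
    simp only [Pi.smul_apply, smul_add]

/-- `div s = 0`, in the sense of distributions, for the periodic field `s` on all of `ℝ^d`. For a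
periodic field this is the meaning of `div s = 0` in the cell together with the anti-periodicity
of the traction `s·n` on the boundary of the cell. -/
def IsDivFree {M : ElasticityTensor d} (s : C.EnergySpace M) : Prop :=
  ∀ i : Fin d, ∀ φ : EuclideanSpace ℝ (Fin d) → ℝ, ContDiff ℝ ∞ φ → HasCompactSupport φ →
    ∫ x, ∑ j, s.val x i j * fderiv ℝ φ x (EuclideanSpace.single j 1) = 0

/-- `𝐒₀`: the self-equilibrated fields, i.e. the divergence-free fields with zero average. -/
noncomputable def selfEquilibratedFields (M : ElasticityTensor d) :
    Submodule ℝ (C.EnergySpace M) where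
  carrier := {s | C.IsDivFree s ∧ ∀ i j, ⨍ x in C.cell, s.val x i j = 0}
  add_mem' := by
    rintro a b ⟨ha, ha'⟩ ⟨hb, hb'⟩
    refine ⟨fun i φ hφ hc => ?_, fun i j => ?_⟩
    · have e : ∫ x, ∑ j, (a + b).val x i j * fderiv ℝ φ x (EuclideanSpace.single j 1) =
          ∫ x, (∑ j, a.val x i j * fderiv ℝ φ x (EuclideanSpace.single j 1) +
            ∑ j, b.val x i j * fderiv ℝ φ x (EuclideanSpace.single j 1)) := by
        refine integral_congr_ae ?_
        filter_upwards [EnergySpace.val_add a b] with x hx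
        simp only [hx, Pi.add_apply, add_mul, Finset.sum_add_distrib]
      rw [e, integral_add, ha i φ hφ hc, hb i φ hφ hc, add_zero]
      · exact integrable_finsetSum _ fun j _ => integrable_test_deriv (f := a.comp i j) hφ hc _
      · exact integrable_finsetSum _ fun j _ => integrable_test_deriv (f := b.comp i j) hφ hc _
    · have hfin : IsFiniteMeasure (volume.restrict C.cell) :=
        ⟨by simpa using C.volume_cell.2.lt_top⟩
      have e : ∫ x in C.cell, (a + b).val x i j =
          ∫ x in C.cell, (a.val x i j + b.val x i j) := by
        refine integral_congr_ae (ae_restrict_of_ae ?_)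
        filter_upwards [EnergySpace.val_add a b] with x hx
        simp only [hx, Pi.add_apply]
      have h1 := ha' i j
      have h2 := hb' i j
      rw [setAverage_eq] at h1 h2 ⊢
      have h3 : Integrable (fun x => a.val x i j) (volume.restrict C.cell) :=
        (C.memLp_cell (a.comp i j)).integrable (by norm_num)
      have h4 : Integrable (fun x => b.val x i j) (volume.restrict C.cell) :=
        (C.memLp_cell (b.comp i j)).integrable (by norm_num)
      rw [e, integral_add h3 h4, smul_add, h1, h2, add_zero]
  zero_mem' := by
    have h : ∀ᵐ x ∂volume, (0 : C.EnergySpace M).val x = 0 := by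
      filter_upwards [EnergySpace.val_smul 0 (0 : C.EnergySpace M)] with x hx
      rwa [zero_smul, zero_smul] at hx
    refine ⟨fun i φ hφ hc => ?_, fun i j => ?_⟩
    · refine integral_eq_zero_of_ae ?_
      filter_upwards [h] with x hx
      simp [hx]
    · rw [setAverage_eq, integral_eq_zero_of_ae, smul_zero]
      refine ae_restrict_of_ae ?_
      filter_upwards [h] with x hx
      simp [hx]
  smul_mem' := by
    rintro c a ⟨ha, ha'⟩
    refine ⟨fun i φ hφ hc => ?_, fun i j => ?_⟩
    · have e : ∫ x, ∑ j, (c • a).val x i j * fderiv ℝ φ x (EuclideanSpace.single j 1) =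
          ∫ x, c * ∑ j, a.val x i j * fderiv ℝ φ x (EuclideanSpace.single j 1) := by
        refine integral_congr_ae ?_
        filter_upwards [EnergySpace.val_smul c a] with x hx
        simp only [hx, Pi.smul_apply, smul_eq_mul, mul_assoc, Finset.mul_sum]
      rw [e, integral_const_mul, ha i φ hφ hc, mul_zero]
    · have e : ∫ x in C.cell, (c • a).val x i j = ∫ x in C.cell, c * a.val x i j := by
        refine integral_congr_ae (ae_restrict_of_ae ?_)
        filter_upwards [EnergySpace.val_smul c a] with x hx
        simp only [hx, Pi.smul_apply, smul_eq_mul]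
      have h1 := ha' i j
      rw [setAverage_eq] at h1 ⊢
      rw [e, integral_const_mul, smul_eq_mul, mul_left_comm, ← smul_eq_mul (a := _⁻¹), h1, mul_zero]

/-! ### Strain and stress spaces and the Green's operators -/

variable (L : ElasticityTensor d)

/-- `𝐇_e`: strain fields, with the scalar product `⟨L₀ η : η'⟩`. -/
abbrev StrainSpace : Type := C.EnergySpace L

/-- `𝐇_s`: stress fields, with the scalar product `⟨τ : L₀⁻¹ τ'⟩` (equal to `⟨L₀⁻¹ τ : τ'⟩`, by the
symmetry of `L₀⁻¹`). -/
abbrev StressSpace : Type := C.EnergySpace L.inv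

/-- `L₀ : 𝐇_e → 𝐇_s`. -/
noncomputable def stiffness (η : C.StrainSpace L) : C.StressSpace L := η.applyTensor L

/-- `L₀⁻¹ : 𝐇_s → 𝐇_e`. -/
noncomputable def compliance (τ : C.StressSpace L) : C.StrainSpace L := τ.applyTensor L.inv

/-- `𝐔_e`, the uniform strains. -/
def Ue : Submodule ℝ (C.StrainSpace L) := C.uniformFields L

/-- `𝐄₀`, the compatible strains. -/
noncomputable def E0 : Submodule ℝ (C.StrainSpace L) := C.compatibleFields L

/-- `𝐄 = 𝐔_e ⊕ 𝐄₀`, the admissible strains. -/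
noncomputable def admE : Submodule ℝ (C.StrainSpace L) := C.Ue L ⊔ C.E0 L

/-- `𝐔_s`, the uniform stresses. -/
noncomputable def Us : Submodule ℝ (C.StressSpace L) := C.uniformFields L.inv

/-- `𝐒₀`, the self-equilibrated stresses. -/
noncomputable def S0 : Submodule ℝ (C.StressSpace L) := C.selfEquilibratedFields L.inv

/-- `𝐒 = 𝐔_s ⊕ 𝐒₀`, the admissible stresses. -/
noncomputable def admS : Submodule ℝ (C.StressSpace L) := C.Us L ⊔ C.S0 L

/-- `e ∈ 𝐄₀` solves the Eshelby problem with data `τ`: `L₀ e - τ ∈ 𝐒`. -/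
def SolvesStrain (τ : C.StressSpace L) (e : C.StrainSpace L) : Prop :=
  e ∈ C.E0 L ∧ C.stiffness L e - τ ∈ C.admS L

/-- `s ∈ 𝐒₀` solves the dual problem with data `η`: `L₀⁻¹ s - η ∈ 𝐄`. -/
def SolvesStress (η : C.StrainSpace L) (s : C.StressSpace L) : Prop :=
  s ∈ C.S0 L ∧ C.compliance L s - η ∈ C.admE L

open Classical in
/-- The periodic strain Green's operator `Γ₀ : 𝐇_s → 𝐇_e`; `Γ₀ τ` is the solution of the Eshelby
problem with data `τ`. -/
noncomputable def Gamma0 (τ : C.StressSpace L) : C.StrainSpace L :=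
  if h : ∃ e, C.SolvesStrain L τ e then h.choose else 0

open Classical in
/-- The periodic stress Green's operator `Δ₀ : 𝐇_e → 𝐇_s`; `Δ₀ η` is the solution of the dual
problem with data `η`. -/
noncomputable def Delta0 (η : C.StrainSpace L) : C.StressSpace L :=
  if h : ∃ s, C.SolvesStress L η s then h.choose else 0

end PeriodicCell

/-- The map `P` is the orthogonal projector of the inner product space `H` onto `K`. -/
def IsOrthogonalProjector {H : Type*} [NormedAddCommGroup H] [InnerProductSpace ℝ H]
    (K : Submodule ℝ H) (P : H → H) : Prop :=
  ∃ _ : K.HasOrthogonalProjection, ∀ η, K.starProjection η = P η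

/-! Everything follows from one splitting, `exists_decomposition`: each strain field is a uniform
field plus an element of `E₀` plus `L₀⁻¹` of an element of `S₀`. To obtain it, project `η`
orthogonally onto the closed subspace `E₀` and remove the mean. The remainder is orthogonal to `E₀`
and has zero mean, so `L₀` maps it into `S₀`, because a stress is divergence-free exactly when it
does no work on compatible strains (`mem_E0_orthogonal_iff`). The second component solves the
Eshelby problem with data `L₀ η`, and the stress in the third solves the dual problem with data `η`.
Both solutions are unique, since a difference of two solutions is orthogonal to itself. Hence the
components are `Γ₀ L₀ η` and `L₀⁻¹ Δ₀ η`. Applying `L₀` to the splitting of `L₀⁻¹ τ` gives the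
stress version, in which the two Green's operators exchange roles.

The analysis is done with Fourier series. Lattice coordinates identify periodic fields with
functions on the torus, and `∂_j` becomes multiplication by `2πi ξ_j(k)`, where `ξ(k)` is the wave
vector `freq`. Then `div s = 0` means `∑_j ξ_j ŝ_ij(k) = 0` for all `k` (`isDivFree_iff`), and `e`
is compatible exactly when each `ê(k)` lies in the range of `a ↦ (a ⊗ ξ + ξ ⊗ a)/2`
(`mem_compatibleFields_iff`). The hard direction of the latter sums single modes to a displacement
in `H¹_per`, using Korn's inequality in each mode and a positive lower bound on the nonzero wave
vectors. Since the condition is closed in each mode, `E₀` is closed (`isClosed_compatibleFields`).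
Parseval's identity gives the orthogonality of compatible and divergence-free fields.

Completeness holds because coercivity makes the energy norm equivalent to the `L²` norm of the
components on the torus. -/

namespace PeriodicCell

/-! ### Lattice coordinates and integration on the torus. -/

variable {d : ℕ} (C : PeriodicCell d)

/-- The normalized Haar measure of the torus `(ℝ/ℤ)^d`. -/
noncomputable def torusMeasure (d : ℕ) : Measure (UnitAddTorus (Fin d)) :=
  Measure.pi fun _ => AddCircle.haarAddCircle

instance : IsProbabilityMeasure (torusMeasure d) :=
  inferInstanceAs (IsProbabilityMeasure (Measure.pi fun _ => AddCircle.haarAddCircle))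

/-- The space of complex square-integrable functions on the torus. -/
abbrev TorusL2 (d : ℕ) : Type := Lp ℂ 2 (torusMeasure d)

/-- The Hilbert basis of characters of the torus. -/
noncomputable def charBasis (d : ℕ) : HilbertBasis (Fin d → ℤ) ℂ (TorusL2 d) :=
  UnitAddTorus.mFourierBasis

theorem coeFn_charBasis (k : Fin d → ℤ) :
    charBasis d k =ᵐ[torusMeasure d] UnitAddTorus.mFourier k := by
  have h : charBasis d k = UnitAddTorus.mFourierLp 2 k :=
    congrFun (UnitAddTorus.coe_mFourierBasis (d := Fin d)) k
  rw [h]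
  exact UnitAddTorus.coeFn_mFourierLp 2 k

/-- The projection of `ℝ^d` onto the torus, in lattice coordinates. -/
noncomputable def proj (x : EuclideanSpace ℝ (Fin d)) : UnitAddTorus (Fin d) :=
  fun i => ((C.vec.repr x i : ℝ) : UnitAddCircle)

theorem continuous_proj : Continuous C.proj := by
  refine continuous_pi fun i => (AddCircle.continuous_mk' 1).comp ?_
  exact (LinearMap.continuous_of_finiteDimensional (C.vec.coord i))

theorem proj_add_of_mem {Y : EuclideanSpace ℝ (Fin d)} (hY : Y ∈ C.lattice)
    (x : EuclideanSpace ℝ (Fin d)) : C.proj (x + Y) = C.proj x := by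
  have h : Y ∈ Submodule.span ℤ (Set.range C.vec) := hY
  rw [C.vec.mem_span_iff_repr_mem ℤ] at h
  funext i
  obtain ⟨n, hn⟩ := h i
  simp only [proj, map_add, Finsupp.add_apply, AddCircle.coe_add]
  rw [← hn]
  simp only [algebraMap_int_eq, eq_intCast, add_eq_left]
  rw [AddCircle.coe_eq_zero_iff]
  exact ⟨n, by simp⟩

/-- The representative in the fundamental parallelepiped of a point of the torus. -/
noncomputable def lift (t : UnitAddTorus (Fin d)) : EuclideanSpace ℝ (Fin d) :=
  ∑ i, (AddCircle.equivIco 1 0 (t i) : ℝ) • C.vec i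

theorem measurable_lift : Measurable C.lift := by
  refine Finset.measurable_sum _ fun i _ => Measurable.smul_const ?_ _
  exact measurable_subtype_coe.comp
    ((AddCircle.measurableEquivIco 1 0).measurable.comp (measurable_pi_apply i))

theorem lift_proj (x : EuclideanSpace ℝ (Fin d)) : C.lift (C.proj x) = ZSpan.fract C.vec x := by
  conv_rhs => rw [← C.vec.sum_repr (ZSpan.fract C.vec x)]
  refine Finset.sum_congr rfl fun i _ => ?_
  rw [ZSpan.repr_fract_apply, proj, AddCircle.coe_equivIco_mk_apply]
  simp

theorem fract_eq_add (x : EuclideanSpace ℝ (Fin d)) :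
    ∃ g : C.lattice, ZSpan.fract C.vec x = x + g :=
  ⟨-⟨(ZSpan.floor C.vec x : EuclideanSpace ℝ (Fin d)), (ZSpan.floor C.vec x).2⟩, by
    simp [ZSpan.fract_apply, sub_eq_add_neg]⟩

theorem map_mk_cube :
    (volume.restrict (Set.univ.pi fun _ : Fin d => Set.Ico (0 : ℝ) 1)).map
      (fun y i => ((y i : ℝ) : UnitAddCircle)) = torusMeasure d := by
  rw [volume_pi, Measure.restrict_pi_pi]
  refine (measurePreserving_pi _ _ fun i => ?_).map_eq
  have h := AddCircle.measurePreserving_mk 1 (0 : ℝ)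
  rw [AddCircle.volume_eq_smul_haarAddCircle, ENNReal.ofReal_one, one_smul, zero_add] at h
  rwa [Measure.restrict_congr_set (Ico_ae_eq_Ioc)]

theorem isAddFundamentalDomain_parallelepiped :
    IsAddFundamentalDomain C.lattice (ZSpan.fundamentalDomain C.vec) volume :=
  ZSpan.isAddFundamentalDomain' C.vec volume

/-- The volume of the fundamental parallelepiped. -/
noncomputable def covol : ENNReal := volume (ZSpan.fundamentalDomain C.vec)

theorem covol_ne_zero : C.covol ≠ 0 := ZSpan.measure_fundamentalDomain_ne_zero C.vec

theorem covol_ne_top : C.covol ≠ ⊤ :=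
  (ZSpan.fundamentalDomain_isBounded C.vec).measure_lt_top.ne

/-- Lattice coordinates send the parallelepiped to the unit cube and Lebesgue measure to a multiple
of itself. The multiple is identified by comparing total masses, so no determinant is computed. -/
theorem map_proj :
    (volume.restrict (ZSpan.fundamentalDomain C.vec)).map C.proj = C.covol • torusMeasure d := by
  set e := C.vec.equivFunL
  have hcube : ZSpan.fundamentalDomain C.vec =
      e ⁻¹' (Set.univ.pi fun _ : Fin d => Set.Ico (0 : ℝ) 1) := by
    ext x
    simp [ZSpan.mem_fundamentalDomain, e]
  have hcm : MeasurableSet (Set.univ.pi fun _ : Fin d => Set.Ico (0 : ℝ) 1) :=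
    MeasurableSet.univ_pi fun _ => measurableSet_Ico
  have hc : (volume : Measure (EuclideanSpace ℝ (Fin d))).map e =
      Measure.addHaarScalarFactor ((volume : Measure (EuclideanSpace ℝ (Fin d))).map e) volume •
        (volume : Measure (Fin d → ℝ)) :=
    Measure.isAddLeftInvariant_eq_smul _ _
  set c := Measure.addHaarScalarFactor ((volume : Measure (EuclideanSpace ℝ (Fin d))).map e)
    (volume : Measure (Fin d → ℝ))
  have hm : Measurable e := e.continuous.measurable
  have hmk : Measurable (fun (y : Fin d → ℝ) i => ((y i : ℝ) : UnitAddCircle)) :=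
    (continuous_pi fun i => (AddCircle.continuous_mk' 1).comp (continuous_apply i)).measurable
  have h1 : (volume.restrict (ZSpan.fundamentalDomain C.vec)).map C.proj = c • torusMeasure d := by
    have hcomp : C.proj = (fun (y : Fin d → ℝ) i => ((y i : ℝ) : UnitAddCircle)) ∘ e := rfl
    rw [hcomp, ← Measure.map_map hmk hm, hcube, ← Measure.restrict_map hm hcm, hc,
      Measure.restrict_smul, Measure.map_smul, map_mk_cube]
  have h2 := congrArg (fun ν : Measure _ => ν Set.univ) h1
  simp only [Measure.map_apply C.continuous_proj.measurable MeasurableSet.univ, Set.preimage_univ,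
    Measure.restrict_apply_univ, Measure.smul_apply, measure_univ] at h2
  have h3 : C.covol = c := by rw [covol, h2, ENNReal.smul_def, smul_eq_mul, mul_one]
  rw [h1, h3]
  rfl

theorem setLIntegral_proj (H : UnitAddTorus (Fin d) → ENNReal) (hH : Measurable H) :
    ∫⁻ x in ZSpan.fundamentalDomain C.vec, H (C.proj x) = C.covol * ∫⁻ t, H t ∂torusMeasure d := by
  rw [← lintegral_map hH C.continuous_proj.measurable, map_proj, lintegral_smul_measure,
    smul_eq_mul]

theorem setIntegral_proj {H : UnitAddTorus (Fin d) → ℂ}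
    (hH : AEStronglyMeasurable H (torusMeasure d)) :
    ∫ x in ZSpan.fundamentalDomain C.vec, H (C.proj x) =
      C.covol.toReal • ∫ t, H t ∂torusMeasure d := by
  rw [← integral_smul_measure, ← map_proj, integral_map C.continuous_proj.measurable.aemeasurable]
  rw [map_proj]
  exact hH.smul_measure _

/-- The preimage of a null set is invariant under the lattice and meets a fundamental domain in a
null set, hence is null. This transfers almost-everywhere identities from the torus to `ℝ^d`. -/
theorem quasiMeasurePreserving_proj :
    Measure.QuasiMeasurePreserving C.proj volume (torusMeasure d) := by
  refine ⟨C.continuous_proj.measurable, Measure.AbsolutelyContinuous.mk fun s hs h0 => ?_⟩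
  rw [Measure.map_apply C.continuous_proj.measurable hs]
  refine C.isAddFundamentalDomain_parallelepiped.measure_zero_of_invariant _ (fun g => ?_) ?_
  · ext x
    rw [Set.mem_vadd_set_iff_neg_vadd_mem, Set.mem_preimage, Set.mem_preimage]
    have h : C.proj (-g +ᵥ x) = C.proj x := by
      change C.proj ((-g : C.lattice).1 + x) = _
      rw [add_comm, C.proj_add_of_mem (-g).2]
    rw [h]
  · rw [← Measure.restrict_apply (C.continuous_proj.measurable hs),
      ← Measure.map_apply C.continuous_proj.measurable hs, map_proj]
    simp [h0]

open scoped Pointwise in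
/-- The projection of a bounded piece of `ℝ^d` covers the torus finitely many times. -/
theorem exists_setLIntegral_proj_le {K : Set (EuclideanSpace ℝ (Fin d))}
    (hK : Bornology.IsBounded K) : ∃ c : ENNReal, c ≠ ⊤ ∧
      ∀ H : UnitAddTorus (Fin d) → ENNReal, Measurable H →
        ∫⁻ x in K, H (C.proj x) ≤ c * ∫⁻ t, H t ∂torusMeasure d := by
  set P := ZSpan.fundamentalDomain C.vec
  have hP : Bornology.IsBounded P := ZSpan.fundamentalDomain_isBounded C.vec
  -- A translate `P + Y` meets `K` only if `Y ∈ K - P`, and a bounded set contains finitely many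
  -- lattice points.
  have hKP : Bornology.IsBounded (K - P) := hK.sub hP
  have hfin := ZSpan.setFinite_inter C.vec hKP
  refine ⟨hfin.toFinset.card * C.covol, by finiteness [C.covol_ne_top], fun H hH => ?_⟩
  have hcov : K ⊆ ⋃ Y ∈ hfin.toFinset, (fun x => x - Y) ⁻¹' P := by
    intro x hx
    simp only [Set.mem_iUnion, Set.Finite.mem_toFinset]
    refine ⟨ZSpan.floor C.vec x, ⟨?_, (ZSpan.floor C.vec x).2⟩, ?_⟩
    · refine ⟨x, hx, ZSpan.fract C.vec x, ZSpan.fract_mem_fundamentalDomain _ _, ?_⟩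
      simp [ZSpan.fract_apply]
    · exact ZSpan.fract_mem_fundamentalDomain _ x
  calc ∫⁻ x in K, H (C.proj x)
      ≤ ∫⁻ x in ⋃ Y ∈ hfin.toFinset, (fun x => x - Y) ⁻¹' P, H (C.proj x) :=
        lintegral_mono_set hcov
    _ ≤ ∑ Y ∈ hfin.toFinset, ∫⁻ x in (fun x => x - Y) ⁻¹' P, H (C.proj x) := by
        induction hfin.toFinset using Finset.induction_on with
        | empty => simp
        | insert a t ha ih =>
          rw [Finset.sum_insert ha, Finset.set_biUnion_insert]
          exact (lintegral_union_le _ _ _).trans (add_le_add_right ih _)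
    _ = ∑ Y ∈ hfin.toFinset, C.covol * ∫⁻ t, H t ∂torusMeasure d := by
        refine Finset.sum_congr rfl fun Y hY => ?_
        have hY' : Y ∈ C.lattice := ((Set.Finite.mem_toFinset _).1 hY).2
        rw [← C.setLIntegral_proj H hH]
        have hmp := (measurePreserving_sub_right (volume : Measure (EuclideanSpace ℝ (Fin d))) Y)
        refine Eq.trans (lintegral_congr fun x => ?_)
          (hmp.setLIntegral_comp_preimage (ZSpan.fundamentalDomain_measurableSet C.vec)
            (hH.comp C.continuous_proj.measurable))
        rw [sub_eq_add_neg, C.proj_add_of_mem (neg_mem hY')]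
    _ = _ := by rw [Finset.sum_const, nsmul_eq_mul, mul_assoc]

/-- Averages over the cell are integrals over the torus. -/
theorem setAverage_proj {H : UnitAddTorus (Fin d) → ℂ}
    (hH : AEStronglyMeasurable H (torusMeasure d)) :
    ⨍ x in C.cell, H (C.proj x) = ∫ t, H t ∂torusMeasure d := by
  have hP := C.isAddFundamentalDomain_parallelepiped
  rw [setAverage_eq, C.tiles'.setIntegral_eq hP, setIntegral_proj _ hH, Measure.real,
    C.tiles'.measure_eq hP, smul_smul, ← covol, inv_mul_cancel₀, one_smul]
  · exact ENNReal.toReal_ne_zero.2 ⟨C.covol_ne_zero, C.covol_ne_top⟩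
  · intro g x
    change H (C.proj (g.1 + x)) = _
    rw [add_comm, C.proj_add_of_mem g.2]

end PeriodicCell

namespace PeriodicCell

/-! ### Periodic functions as square-integrable functions on the torus. -/

variable {d : ℕ} (C : PeriodicCell d)

theorem proj_lift (t : UnitAddTorus (Fin d)) : C.proj (C.lift t) = t := by
  funext i
  have h : C.vec.repr (C.lift t) i = AddCircle.equivIco 1 0 (t i) := by
    rw [lift, C.vec.repr_sum_self (fun i => (AddCircle.equivIco 1 0 (t i) : ℝ))]
  rw [proj, h]
  exact (AddCircle.equivIco 1 0).symm_apply_apply (t i)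

theorem quasiMeasurePreserving_lift :
    Measure.QuasiMeasurePreserving C.lift (torusMeasure d) volume := by
  refine ⟨C.measurable_lift, Measure.AbsolutelyContinuous.mk fun s hs h0 => ?_⟩
  rw [Measure.map_apply C.measurable_lift hs]
  have h1 : (C.covol • torusMeasure d) (C.lift ⁻¹' s) = 0 := by
    rw [← map_proj, Measure.map_apply C.continuous_proj.measurable (C.measurable_lift hs),
      Measure.restrict_apply (C.continuous_proj.measurable (C.measurable_lift hs))]
    refine measure_mono_null ?_ h0
    rintro x ⟨hx, hxP⟩
    rw [Set.mem_preimage, Set.mem_preimage, lift_proj, (ZSpan.fract_eq_self (b := C.vec)).2 hxP]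
      at hx
    exact hx
  rw [Measure.smul_apply, smul_eq_mul, mul_eq_zero] at h1
  exact h1.resolve_left C.covol_ne_zero

theorem apply_lift_proj (f : C.L2per) : ∀ᵐ x ∂volume, f.1 (C.lift (C.proj x)) = f.1 x := by
  have h2 : ∀ᵐ x ∂volume, ∀ g : C.lattice, f.1 (x + g.1) = f.1 x :=
    ae_all_iff.2 fun g => f.2.2 g.1 g.2
  filter_upwards [h2] with x hx
  obtain ⟨g, hg⟩ := C.fract_eq_add x
  rw [lift_proj, hg, hx]

theorem memLp_lift (f : C.L2per) :
    MemLp (fun t => ((f.1 (C.lift t) : ℝ) : ℂ)) 2 (torusMeasure d) := by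
  -- `L2per` depends only on the lattice, so `f` may be regarded over the cell formed by the
  -- parallelepiped.
  have hP : MemLp f.1 2 (volume.restrict (ZSpan.fundamentalDomain C.vec)) :=
    PeriodicCell.memLp_cell ⟨C.vec, _, C.isAddFundamentalDomain_parallelepiped⟩ f
  have hm : Measurable (fun t => f.1 (C.lift t)) :=
    f.1.stronglyMeasurable.measurable.comp C.measurable_lift
  refine MemLp.ofReal ?_
  have h1 : MemLp (fun t => f.1 (C.lift t)) 2 (C.covol • torusMeasure d) := by
    rw [← map_proj, memLp_map_measure_iff hm.aestronglyMeasurable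
      C.continuous_proj.measurable.aemeasurable]
    exact hP.ae_eq ((ae_restrict_of_ae (C.apply_lift_proj f)).mono fun x hx => hx.symm)
  refine h1.of_measure_le_smul (c := C.covol⁻¹) (ENNReal.inv_ne_top.2 C.covol_ne_zero) ?_
  rw [smul_smul, ENNReal.inv_mul_cancel C.covol_ne_zero C.covol_ne_top, one_smul]

/-- A periodic function as a square-integrable function on the torus. -/
noncomputable def toTorus : C.L2per →ₗ[ℝ] TorusL2 d where
  toFun f := (C.memLp_lift f).toLp _
  map_add' f g := by
    rw [← MemLp.toLp_add]
    refine MemLp.toLp_congr _ _ ?_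
    filter_upwards [C.quasiMeasurePreserving_lift.ae (AEEqFun.coeFn_add f.1 g.1)] with t ht
    change (((f.1 + g.1 : _ →ₘ[volume] ℝ) (C.lift t) : ℝ) : ℂ) = _
    rw [ht]
    simp
  map_smul' c f := by
    rw [RingHom.id_apply, ← MemLp.toLp_const_smul]
    refine MemLp.toLp_congr _ _ ?_
    filter_upwards [C.quasiMeasurePreserving_lift.ae (AEEqFun.coeFn_smul c f.1)] with t ht
    change (((c • f.1 : _ →ₘ[volume] ℝ) (C.lift t) : ℝ) : ℂ) = _
    rw [ht]
    simp

theorem coeFn_toTorus (f : C.L2per) :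
    C.toTorus f =ᵐ[torusMeasure d] fun t => ((f.1 (C.lift t) : ℝ) : ℂ) :=
  (C.memLp_lift f).coeFn_toLp

theorem toTorus_proj (f : C.L2per) : ∀ᵐ x ∂volume, C.toTorus f (C.proj x) = (f.1 x : ℂ) := by
  filter_upwards [C.quasiMeasurePreserving_proj.ae (C.coeFn_toTorus f), C.apply_lift_proj f]
    with x h1 h2
  rw [h1, h2]

/-- The constant is a bound for `ψ` times the number of times its support covers the torus. On a
probability space the `L¹` norm is at most the `L²` norm. This is the continuity of
`testFunctional`. -/
theorem exists_lintegral_proj_mul_le {ψ : EuclideanSpace ℝ (Fin d) → ℂ} (hψ : Continuous ψ)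
    (hc : HasCompactSupport ψ) : ∃ c : ENNReal, c ≠ ⊤ ∧
      ∀ F : TorusL2 d, ∫⁻ x, ‖F (C.proj x) * ψ x‖ₑ ≤ c * ‖F‖ₑ := by
  obtain ⟨c, hct, h⟩ := C.exists_setLIntegral_proj_le hc.isCompact.isBounded
  obtain ⟨B, hB⟩ := hψ.bounded_above_of_compact_support hc
  refine ⟨ENNReal.ofReal B * c, by finiteness, fun F => ?_⟩
  have hF : Measurable (fun t => ‖F t‖ₑ) := (Lp.stronglyMeasurable F).measurable.enorm
  calc ∫⁻ x, ‖F (C.proj x) * ψ x‖ₑ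
      = ∫⁻ x in tsupport ψ, ‖F (C.proj x) * ψ x‖ₑ := by
        rw [setLIntegral_eq_of_support_subset]
        intro x hx
        refine subset_tsupport _ fun h0 => hx ?_
        simp [h0]
    _ ≤ ∫⁻ x in tsupport ψ, ENNReal.ofReal B * ‖F (C.proj x)‖ₑ := by
        refine lintegral_mono fun x => ?_
        rw [enorm_mul, mul_comm]
        gcongr
        rw [← ofReal_norm]
        exact ENNReal.ofReal_le_ofReal (hB x)
    _ = ENNReal.ofReal B * ∫⁻ x in tsupport ψ, ‖F (C.proj x)‖ₑ := by
        rw [lintegral_const_mul' _ _ ENNReal.ofReal_ne_top]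
    _ ≤ ENNReal.ofReal B * (c * ∫⁻ t, ‖F t‖ₑ ∂torusMeasure d) := by
        gcongr
        exact h _ hF
    _ ≤ ENNReal.ofReal B * (c * ‖F‖ₑ) := by
        gcongr
        rw [← eLpNorm_one_eq_lintegral_enorm, Lp.enorm_def]
        exact eLpNorm_le_eLpNorm_of_exponent_le (by norm_num) (Lp.aestronglyMeasurable F)
    _ = _ := by rw [mul_assoc]

theorem aestronglyMeasurable_proj (F : TorusL2 d) :
    AEStronglyMeasurable (fun x => F (C.proj x)) volume :=
  ((Lp.stronglyMeasurable F).comp_measurable C.continuous_proj.measurable).aestronglyMeasurable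

theorem integrable_proj_mul {ψ : EuclideanSpace ℝ (Fin d) → ℂ} (hψ : Continuous ψ)
    (hc : HasCompactSupport ψ) (F : TorusL2 d) : Integrable (fun x => F (C.proj x) * ψ x) := by
  obtain ⟨c, hct, h⟩ := C.exists_lintegral_proj_mul_le hψ hc
  exact ⟨(C.aestronglyMeasurable_proj F).mul hψ.aestronglyMeasurable,
    (h F).trans_lt (by finiteness)⟩

/-- Integration over `ℝ^d` of a periodic function against a compactly supported function, as a
functional of the periodic function. -/
noncomputable def testFunctional {ψ : EuclideanSpace ℝ (Fin d) → ℂ} (hψ : Continuous ψ)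
    (hc : HasCompactSupport ψ) : TorusL2 d →L[ℂ] ℂ :=
  LinearMap.mkContinuousOfExistsBound
    { toFun := fun F => ∫ x, F (C.proj x) * ψ x
      map_add' := fun F G => by
        rw [← integral_add (C.integrable_proj_mul hψ hc F) (C.integrable_proj_mul hψ hc G)]
        refine integral_congr_ae ?_
        filter_upwards [C.quasiMeasurePreserving_proj.ae (Lp.coeFn_add F G)] with x hx
        rw [hx, Pi.add_apply, add_mul]
      map_smul' := fun c F => by
        rw [RingHom.id_apply, smul_eq_mul, ← integral_const_mul]
        refine integral_congr_ae ?_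
        filter_upwards [C.quasiMeasurePreserving_proj.ae (Lp.coeFn_smul c F)] with x hx
        rw [hx, Pi.smul_apply, smul_eq_mul, mul_assoc] }
    (by
      obtain ⟨c, hct, h⟩ := C.exists_lintegral_proj_mul_le hψ hc
      refine ⟨c.toReal, fun F => ?_⟩
      rw [← toReal_enorm F, ← ENNReal.toReal_mul, ← toReal_enorm]
      exact ENNReal.toReal_mono (by finiteness) ((enorm_integral_le_lintegral_enorm _).trans (h F)))

theorem testFunctional_apply {ψ : EuclideanSpace ℝ (Fin d) → ℂ} (hψ : Continuous ψ)
    (hc : HasCompactSupport ψ) (F : TorusL2 d) :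
    C.testFunctional hψ hc F = ∫ x, F (C.proj x) * ψ x := rfl

theorem testFunctional_charBasis {ψ : EuclideanSpace ℝ (Fin d) → ℂ} (hψ : Continuous ψ)
    (hc : HasCompactSupport ψ) (k : Fin d → ℤ) :
    C.testFunctional hψ hc (charBasis d k) = ∫ x, UnitAddTorus.mFourier k (C.proj x) * ψ x := by
  rw [testFunctional_apply]
  refine integral_congr_ae ?_
  filter_upwards [C.quasiMeasurePreserving_proj.ae (coeFn_charBasis k)] with x hx
  rw [hx]

/-- A continuous functional may be applied to the Fourier series term by term, so distributional
identities need only be checked on characters. -/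
theorem hasSum_testFunctional {ψ : EuclideanSpace ℝ (Fin d) → ℂ} (hψ : Continuous ψ)
    (hc : HasCompactSupport ψ) (F : TorusL2 d) :
    HasSum (fun k => (charBasis d).repr F k * ∫ x, UnitAddTorus.mFourier k (C.proj x) * ψ x)
      (∫ x, F (C.proj x) * ψ x) := by
  have h := ((charBasis d).hasSum_repr F).mapL (C.testFunctional hψ hc)
  simp only [map_smul, testFunctional_charBasis, smul_eq_mul] at h
  exact h

/-- The real part of a function on the torus, as a periodic function on `ℝ^d`. -/
noncomputable def reField (F : TorusL2 d) : C.L2per :=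
  ⟨AEEqFun.mk (fun x => (F (C.proj x)).re) (C.aestronglyMeasurable_proj F).re, by
    have h0 := AEEqFun.coeFn_mk (fun x => (F (C.proj x)).re) (C.aestronglyMeasurable_proj F).re
    refine ⟨?_, fun Y hY => ?_⟩
    · rw [locallyIntegrable_iff]
      intro K hK
      obtain ⟨c, hct, h⟩ := C.exists_setLIntegral_proj_le hK.isBounded
      refine ⟨((AEEqFun.aestronglyMeasurable _).pow 2).restrict, ?_⟩
      have hF : Measurable (fun t => ‖F t‖ₑ ^ 2) :=
        (Lp.stronglyMeasurable F).measurable.enorm.pow_const 2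
      have hfin : ∫⁻ t, ‖F t‖ₑ ^ 2 ∂torusMeasure d ≠ ⊤ := by
        have h2 := (eLpNorm_lt_top_iff_lintegral_rpow_enorm_lt_top (by norm_num) (by norm_num)).1
          (Lp.eLpNorm_lt_top F)
        simpa using h2.ne
      refine ((lintegral_mono_ae ?_).trans (h _ hF)).trans_lt (by finiteness)
      filter_upwards [ae_restrict_of_ae h0] with x hx
      rw [hx, enorm_pow]
      gcongr
      rw [← ofReal_norm, ← ofReal_norm]
      exact ENNReal.ofReal_le_ofReal (Complex.abs_re_le_norm _)
    · have h := (measurePreserving_add_right volume Y).quasiMeasurePreserving.ae h0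
      filter_upwards [h0, h] with x h1 h2
      rw [h1, h2, C.proj_add_of_mem hY]⟩

theorem coeFn_reField (F : TorusL2 d) : ∀ᵐ x ∂volume, (C.reField F).1 x = (F (C.proj x)).re :=
  AEEqFun.coeFn_mk _ _

theorem reField_toTorus (f : C.L2per) : C.reField (C.toTorus f) = f := by
  refine Subtype.ext (AEEqFun.ext ?_)
  filter_upwards [C.coeFn_reField (C.toTorus f), C.toTorus_proj f] with x h1 h2
  rw [h1, h2, Complex.ofReal_re]

/-- Taking real parts is a contraction that fixes real fields. Limits taken in the complex space can
thus be brought back to `L2per`. -/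
theorem norm_toTorus_reField_sub_le (F : TorusL2 d) (f : C.L2per) :
    ‖C.toTorus (C.reField F - f)‖ ≤ ‖F - C.toTorus f‖ := by
  refine Lp.norm_le_norm_of_ae_le ?_
  have h1 := C.quasiMeasurePreserving_lift.ae (C.coeFn_reField F)
  rw [map_sub]
  filter_upwards [Lp.coeFn_sub (C.toTorus (C.reField F)) (C.toTorus f),
    Lp.coeFn_sub F (C.toTorus f), C.coeFn_toTorus (C.reField F), C.coeFn_toTorus f, h1]
    with t h2 h3 h4 h5 h6
  rw [h2, h3, Pi.sub_apply, Pi.sub_apply, h4, h5, h6, proj_lift, ← Complex.ofReal_sub,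
    Complex.norm_real, Real.norm_eq_abs]
  simpa using Complex.abs_re_le_norm (F t - (f.1 (C.lift t) : ℝ))

/-- The average over the cell of a product, in terms of the scalar product on the torus. -/
theorem setAverage_mul_reField (f : C.L2per) (F : TorusL2 d) :
    ⨍ x in C.cell, f.1 x * (C.reField F).1 x = (inner ℂ (C.toTorus f) F).re := by
  have hint : Integrable (fun t => inner ℂ (C.toTorus f t) (F t)) (torusMeasure d) :=
    L2.integrable_inner _ _
  rw [L2.inner_def, ← RCLike.re_to_complex, ← integral_re hint,
    ← Complex.ofReal_inj, ← integral_complex_ofReal, ← C.setAverage_proj, setAverage_eq, setAverage_eq,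
    Complex.real_smul]
  · rw [smul_eq_mul, Complex.ofReal_mul, ← integral_complex_ofReal]
    congr 1
    refine integral_congr_ae (ae_restrict_of_ae ?_)
    filter_upwards [C.coeFn_reField F, C.toTorus_proj f] with x h1 h2
    rw [h1, h2]
    simp [mul_comm]
  · exact hint.re.ofReal.aestronglyMeasurable

theorem setAverage_mul (f g : C.L2per) :
    ⨍ x in C.cell, f.1 x * g.1 x = (inner ℂ (C.toTorus f) (C.toTorus g)).re := by
  rw [← setAverage_mul_reField, reField_toTorus]

end PeriodicCell

namespace PeriodicCell

/-! ### Weak derivatives and divergence in terms of Fourier coefficients. -/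

variable {d : ℕ} (C : PeriodicCell d)

/-- The linear form `x ↦ ∑ k_m x_m` in lattice coordinates. -/
noncomputable def waveForm (k : Fin d → ℤ) : EuclideanSpace ℝ (Fin d) →L[ℝ] ℝ :=
  LinearMap.toContinuousLinearMap (∑ m, (k m : ℝ) • C.vec.coord m)

theorem waveForm_apply (k : Fin d → ℤ) (x : EuclideanSpace ℝ (Fin d)) :
    C.waveForm k x = ∑ m, (k m : ℝ) * C.vec.repr x m := by
  simp [waveForm]

theorem mFourier_proj (k : Fin d → ℤ) (x : EuclideanSpace ℝ (Fin d)) :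
    UnitAddTorus.mFourier k (C.proj x) =
      Complex.exp (2 * Real.pi * Complex.I * (C.waveForm k x : ℝ)) := by
  simp only [UnitAddTorus.mFourier, proj, ContinuousMap.coe_mk, fourier_coe_apply,
    ← Complex.exp_sum, waveForm_apply]
  congr 1
  push_cast
  rw [Finset.mul_sum]
  refine Finset.sum_congr rfl fun m _ => ?_
  ring

theorem contDiff_mFourier_proj (k : Fin d → ℤ) :
    ContDiff ℝ ∞ (fun x => UnitAddTorus.mFourier k (C.proj x)) := by
  simp only [mFourier_proj]
  exact (contDiff_const.mul (Complex.ofRealCLM.contDiff.comp (C.waveForm k).contDiff)).cexp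

theorem fderiv_mFourier_proj (k : Fin d → ℤ) (x v : EuclideanSpace ℝ (Fin d)) :
    fderiv ℝ (fun x => UnitAddTorus.mFourier k (C.proj x)) x v =
      2 * Real.pi * Complex.I * C.waveForm k v * UnitAddTorus.mFourier k (C.proj x) := by
  simp only [mFourier_proj]
  have h1 : HasFDerivAt (fun y => ((C.waveForm k y : ℝ) : ℂ))
      (Complex.ofRealCLM.comp (C.waveForm k)) x :=
    Complex.ofRealCLM.hasFDerivAt.comp x (C.waveForm k).hasFDerivAt
  rw [((h1.const_mul (2 * Real.pi * Complex.I)).cexp).fderiv]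
  simp
  ring

theorem integral_mFourier_mul_fderiv {φ : EuclideanSpace ℝ (Fin d) → ℂ} (hφ : ContDiff ℝ ∞ φ)
    (hc : HasCompactSupport φ) (k : Fin d → ℤ) (v : EuclideanSpace ℝ (Fin d)) :
    ∫ x, UnitAddTorus.mFourier k (C.proj x) * fderiv ℝ φ x v =
      -(2 * Real.pi * Complex.I * C.waveForm k v) *
        ∫ x, UnitAddTorus.mFourier k (C.proj x) * φ x := by
  have he := C.contDiff_mFourier_proj k
  have hd : Continuous fun x => fderiv ℝ φ x v :=
    hφ.continuous_fderiv_apply (by simp) |>.comp (by fun_prop : Continuous fun x => (x, v))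
  rw [integral_mul_fderiv_eq_neg_fderiv_mul_of_integrable]
  · simp only [fderiv_mFourier_proj, mul_assoc _ (UnitAddTorus.mFourier k _), neg_mul]
    rw [integral_const_mul]
  · simp only [fderiv_mFourier_proj]
    exact ((continuous_const.mul he.continuous).mul hφ.continuous).integrable_of_hasCompactSupport
      hc.mul_left
  · exact (he.continuous.mul hd).integrable_of_hasCompactSupport (hc.fderiv_apply ℝ v).mul_left
  · exact (he.continuous.mul hφ.continuous).integrable_of_hasCompactSupport hc.mul_left
  · exact fun x _ => he.differentiable (by simp) x
  · exact fun x _ => hφ.differentiable (by simp) x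

theorem integral_mFourier (n : Fin d → ℤ) :
    ∫ t, UnitAddTorus.mFourier n t ∂torusMeasure d = if n = 0 then 1 else 0 := by
  have h := orthonormal_iff_ite.1 (charBasis d).orthonormal 0 n
  rw [L2.inner_def] at h
  simp only [eq_comm (a := n)]
  rw [← h]
  refine integral_congr_ae ?_
  filter_upwards [coeFn_charBasis (d := d) 0, coeFn_charBasis n] with t h1 h2
  rw [h1, h2, UnitAddTorus.mFourier_zero]
  simp

theorem exists_bump (d : ℕ) : ∃ ρ : EuclideanSpace ℝ (Fin d) → ℝ, ContDiff ℝ ∞ ρ ∧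
    HasCompactSupport ρ ∧ ∫ x, ρ x = 1 := by
  let b : ContDiffBump (0 : EuclideanSpace ℝ (Fin d)) := ⟨1, 2, one_pos, one_lt_two⟩
  exact ⟨b.normed volume, b.contDiff_normed, b.hasCompactSupport_normed, b.integral_normed⟩

/-- Weak derivatives are defined by real test functions. Composing a complex test function with each
real functional `T` reduces complex identities to real ones. -/
theorem eq_of_forall_real_clm {z w : ℂ} (h : ∀ T : ℂ →L[ℝ] ℝ, T z = T w) : z = w :=
  Complex.ext (h Complex.reCLM) (h Complex.imCLM)

open scoped Convolution in
theorem mul_convolution {e : EuclideanSpace ℝ (Fin d) → ℂ} (he : ∀ x y, e (x + y) = e x * e y)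
    (f g : EuclideanSpace ℝ (Fin d) → ℂ) (x : EuclideanSpace ℝ (Fin d)) :
    e x * (f ⋆[ContinuousLinearMap.mul ℝ ℂ, volume] g) x =
      ((fun t => e t * f t) ⋆[ContinuousLinearMap.mul ℝ ℂ, volume] (fun t => e t * g t)) x := by
  simp only [convolution_def, ContinuousLinearMap.mul_apply']
  rw [← integral_const_mul]
  refine integral_congr_ae (Filter.Eventually.of_forall fun t => ?_)
  have h : e x = e t * e (x - t) := by rw [← he, add_sub_cancel]
  simp only [h]
  ring

theorem mFourier_proj_add (n : Fin d → ℤ) (x y : EuclideanSpace ℝ (Fin d)) :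
    UnitAddTorus.mFourier n (C.proj (x + y)) =
      UnitAddTorus.mFourier n (C.proj x) * UnitAddTorus.mFourier n (C.proj y) := by
  rw [mFourier_proj, mFourier_proj, mFourier_proj, ← Complex.exp_add, map_add, Complex.ofReal_add,
    mul_add]

open scoped Convolution in
-- A character is multiplicative, so it passes inside the convolution and the integral factorizes.
-- Orthogonality of characters on the parallelepiped kills the first factor unless `n = 0`.
theorem integral_mFourier_mul_convolution {g : EuclideanSpace ℝ (Fin d) → ℂ} (hg : Continuous g)
    (hgc : HasCompactSupport g) (r : ℂ) (n : Fin d → ℤ) :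
    ∫ x, UnitAddTorus.mFourier n (C.proj x) *
      ((ZSpan.fundamentalDomain C.vec).indicator (fun _ => r)
        ⋆[ContinuousLinearMap.mul ℝ ℂ, volume] g) x =
      (C.covol.toReal * (if n = 0 then 1 else 0) * r) *
        ∫ x, UnitAddTorus.mFourier n (C.proj x) * g x := by
  have hPm := ZSpan.fundamentalDomain_measurableSet C.vec
  have hPb := ZSpan.fundamentalDomain_isBounded C.vec
  have hec : Continuous fun x => UnitAddTorus.mFourier n (C.proj x) :=
    (C.contDiff_mFourier_proj n).continuous
  have hmul := mul_convolution (e := fun x => UnitAddTorus.mFourier n (C.proj x)) (C.mFourier_proj_add n)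
    ((ZSpan.fundamentalDomain C.vec).indicator fun _ => r) g
  have hefi : (fun t => UnitAddTorus.mFourier n (C.proj t) *
      (ZSpan.fundamentalDomain C.vec).indicator (fun _ => r) t) =
      (ZSpan.fundamentalDomain C.vec).indicator
        fun t => UnitAddTorus.mFourier n (C.proj t) * r := by
    ext t
    by_cases ht : t ∈ ZSpan.fundamentalDomain C.vec <;> simp [ht]
  have hef : Integrable ((ZSpan.fundamentalDomain C.vec).indicator
      fun t => UnitAddTorus.mFourier n (C.proj t) * r) := by
    rw [integrable_indicator_iff hPm]
    exact ((hec.mul continuous_const).locallyIntegrable.integrableOn_isCompact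
      hPb.isCompact_closure).mono_set subset_closure
  have heg : Integrable fun t => UnitAddTorus.mFourier n (C.proj t) * g t :=
    (hec.mul hg).integrable_of_hasCompactSupport hgc.mul_left
  rw [integral_congr_ae (Filter.Eventually.of_forall hmul), hefi,
    integral_convolution _ hef heg, ContinuousLinearMap.mul_apply',
    integral_indicator hPm, integral_mul_const,
    C.setIntegral_proj (UnitAddTorus.mFourier n).continuous.aestronglyMeasurable,
    integral_mFourier, Complex.real_smul]

open scoped Convolution in
/-- A smooth cutoff whose lattice translates form a partition of unity up to a constant factor. -/
theorem exists_cutoff : ∃ χ : EuclideanSpace ℝ (Fin d) → ℂ, ContDiff ℝ ∞ χ ∧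
    HasCompactSupport χ ∧ ∀ n : Fin d → ℤ,
      ∫ x, UnitAddTorus.mFourier n (C.proj x) * χ x = if n = 0 then 1 else 0 := by
  obtain ⟨ρ, hρ, hρc, hρ1⟩ := exists_bump d
  have hPb := ZSpan.fundamentalDomain_isBounded C.vec
  -- The cutoff is a mollified indicator of the parallelepiped; dividing by its volume makes the
  -- coefficient at `n = 0` equal to one.
  obtain ⟨r, hr⟩ : ∃ r : ℂ, (C.covol.toReal : ℂ) * r = 1 := by
    refine ⟨_, mul_inv_cancel₀ ?_⟩
    exact_mod_cast ENNReal.toReal_ne_zero.2 ⟨C.covol_ne_zero, C.covol_ne_top⟩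
  have hf : Integrable ((ZSpan.fundamentalDomain C.vec).indicator fun _ => r) := by
    rw [integrable_indicator_iff (ZSpan.fundamentalDomain_measurableSet C.vec)]
    exact integrableOn_const hPb.measure_lt_top.ne
  have hg : ContDiff ℝ ∞ fun x => (ρ x : ℂ) := Complex.ofRealCLM.contDiff.comp hρ
  have hgc : HasCompactSupport fun x => (ρ x : ℂ) := hρc.comp_left Complex.ofReal_zero
  have hfc : HasCompactSupport ((ZSpan.fundamentalDomain C.vec).indicator fun _ => r) := by
    refine HasCompactSupport.intro hPb.isCompact_closure fun x hx => ?_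
    exact Set.indicator_of_notMem (fun h => hx (subset_closure h)) _
  have hχ : ContDiff ℝ ∞ ((ZSpan.fundamentalDomain C.vec).indicator (fun _ => r)
      ⋆[ContinuousLinearMap.mul ℝ ℂ, volume] fun x => (ρ x : ℂ)) :=
    hgc.contDiff_convolution_right (n := ⊤) _ hf.locallyIntegrable hg
  have hχc : HasCompactSupport ((ZSpan.fundamentalDomain C.vec).indicator (fun _ => r)
      ⋆[ContinuousLinearMap.mul ℝ ℂ, volume] fun x => (ρ x : ℂ)) :=
    hfc.convolution _ hgc
  refine ⟨_, hχ, hχc, fun n => ?_⟩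
  rw [C.integral_mFourier_mul_convolution hg.continuous hgc]
  split_ifs with hn
  · subst hn
    simp only [UnitAddTorus.mFourier_zero, ContinuousMap.one_apply, one_mul, mul_one, hr]
    rw [integral_complex_ofReal, hρ1, Complex.ofReal_one]
  · simp

/-- Test functions that extract the Fourier coefficient of index `m` of periodic functions. -/
theorem exists_coefficient_test (m : Fin d → ℤ) : ∃ φ : EuclideanSpace ℝ (Fin d) → ℂ,
    ContDiff ℝ ∞ φ ∧ HasCompactSupport φ ∧
    (∀ F : TorusL2 d, ∫ x, F (C.proj x) * φ x = (charBasis d).repr F m) ∧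
    ∀ (F : TorusL2 d) (v : EuclideanSpace ℝ (Fin d)), ∫ x, F (C.proj x) * fderiv ℝ φ x v =
      -(2 * Real.pi * Complex.I * C.waveForm m v) * (charBasis d).repr F m := by
  obtain ⟨χ, hχ, hχc, h⟩ := C.exists_cutoff
  -- The character of index `-m` shifts frequencies: testing mode `k` with `φ` is testing mode `k -
  -- m` with `χ`.
  let φ : EuclideanSpace ℝ (Fin d) → ℂ := fun x => UnitAddTorus.mFourier (-m) (C.proj x) * χ x
  have hφ : ContDiff ℝ ∞ φ := (C.contDiff_mFourier_proj (-m)).mul hχ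
  have hφc : HasCompactSupport φ := hχc.mul_left
  have hφk : ∀ k, ∫ x, UnitAddTorus.mFourier k (C.proj x) * φ x = if k = m then 1 else 0 := by
    intro k
    simp only [φ, ← mul_assoc, ← UnitAddTorus.mFourier_add]
    rw [h]
    simp only [← sub_eq_add_neg, sub_eq_zero]
  refine ⟨φ, hφ, hφc, fun F => ?_, fun F v => ?_⟩
  · have h1 := C.hasSum_testFunctional hφ.continuous hφc F
    simp only [hφk] at h1
    refine h1.unique ((hasSum_ite_eq m ((charBasis d).repr F m)).congr_fun fun k => ?_)
    split_ifs with hk <;> simp [hk]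
  · have hd : Continuous fun x => fderiv ℝ φ x v :=
      hφ.continuous_fderiv_apply (by simp) |>.comp (by fun_prop : Continuous fun x => (x, v))
    have h1 := C.hasSum_testFunctional hd (hφc.fderiv_apply ℝ v) F
    simp only [C.integral_mFourier_mul_fderiv hφ hφc, hφk] at h1
    refine h1.unique ((hasSum_ite_eq m (-(2 * Real.pi * Complex.I * C.waveForm m v) *
      (charBasis d).repr F m)).congr_fun fun k => ?_)
    split_ifs with hk
    · rw [hk]; ring
    · simp

/-- Integration by parts against test functions, in terms of Fourier coefficients. -/
theorem integral_mul_fderiv_of_repr {F G : TorusL2 d} {v : EuclideanSpace ℝ (Fin d)}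
    (h : ∀ k, (charBasis d).repr G k =
      2 * Real.pi * Complex.I * C.waveForm k v * (charBasis d).repr F k)
    {φ : EuclideanSpace ℝ (Fin d) → ℂ} (hφ : ContDiff ℝ ∞ φ) (hc : HasCompactSupport φ) :
    ∫ x, F (C.proj x) * fderiv ℝ φ x v = -∫ x, G (C.proj x) * φ x := by
  have hd : Continuous fun x => fderiv ℝ φ x v :=
    hφ.continuous_fderiv_apply (by simp) |>.comp (by fun_prop : Continuous fun x => (x, v))
  have h1 := C.hasSum_testFunctional hd (hc.fderiv_apply ℝ v) F
  refine h1.unique ?_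
  convert! (C.hasSum_testFunctional hφ.continuous hc G).neg using 2 with k
  rw [C.integral_mFourier_mul_fderiv hφ hc, h]
  ring

theorem map_integral_toTorus (T : ℂ →L[ℝ] ℝ) (f : C.L2per)
    {ψ : EuclideanSpace ℝ (Fin d) → ℂ} (hψ : Continuous ψ) (hc : HasCompactSupport ψ) :
    T (∫ x, C.toTorus f (C.proj x) * ψ x) = ∫ x, f.1 x * T (ψ x) := by
  rw [← T.integral_comp_comm (C.integrable_proj_mul hψ hc _)]
  refine integral_congr_ae ?_
  filter_upwards [C.toTorus_proj f] with x hx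
  rw [hx, ← Complex.real_smul, map_smul, smul_eq_mul]

theorem fderiv_clm_comp (T : ℂ →L[ℝ] ℝ) {φ : EuclideanSpace ℝ (Fin d) → ℂ}
    (hφ : ContDiff ℝ ∞ φ) (x v : EuclideanSpace ℝ (Fin d)) :
    fderiv ℝ (fun y => T (φ y)) x v = T (fderiv ℝ φ x v) := by
  have h := T.hasFDerivAt.comp x (hφ.differentiable (by simp) x).hasFDerivAt
  exact congrArg (fun A : _ →L[ℝ] ℝ => A v) h.fderiv

/-- The test function of `exists_coefficient_test` reads off the coefficients of both sides of the
integration by parts. -/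
theorem IsWeakPartial.repr_eq {j : Fin d} {f g : C.L2per} (h : C.IsWeakPartial j f g)
    (k : Fin d → ℤ) : (charBasis d).repr (C.toTorus g) k =
      2 * Real.pi * Complex.I * C.waveForm k (EuclideanSpace.single j 1) *
        (charBasis d).repr (C.toTorus f) k := by
  obtain ⟨φ, hφ, hc, h1, h2⟩ := C.exists_coefficient_test k
  have hd : Continuous fun x => fderiv ℝ φ x (EuclideanSpace.single j 1) :=
    hφ.continuous_fderiv_apply (by simp) |>.comp
      (by fun_prop : Continuous fun x => (x, EuclideanSpace.single j (1 : ℝ)))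
  have key : ∀ T : ℂ →L[ℝ] ℝ,
      T (∫ x, C.toTorus f (C.proj x) * fderiv ℝ φ x (EuclideanSpace.single j 1)) =
        T (-∫ x, C.toTorus g (C.proj x) * φ x) := by
    intro T
    rw [map_neg, C.map_integral_toTorus T f hd (hc.fderiv_apply ℝ _),
      C.map_integral_toTorus T g hφ.continuous hc,
      ← h (fun x => T (φ x)) (T.contDiff.comp hφ) (hc.comp_left (map_zero T))]
    simp only [fderiv_clm_comp T hφ]
  have h3 := eq_of_forall_real_clm key
  rw [h1, h2] at h3
  linear_combination h3

/-- The test function is real, so one may take real parts in the complex integration by parts. No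
conjugate symmetry of the coefficients of `F` or `G` is needed. -/
theorem isWeakPartial_reField {F G : TorusL2 d} {j : Fin d}
    (h : ∀ k, (charBasis d).repr G k =
      2 * Real.pi * Complex.I * C.waveForm k (EuclideanSpace.single j 1) *
        (charBasis d).repr F k) : C.IsWeakPartial j (C.reField F) (C.reField G) := by
  intro φ hφ hc
  have hφ' : ContDiff ℝ ∞ fun x => (φ x : ℂ) := Complex.ofRealCLM.contDiff.comp hφ
  have hc' : HasCompactSupport fun x => (φ x : ℂ) := hc.comp_left Complex.ofReal_zero
  have hd : Continuous fun x => fderiv ℝ (fun x => (φ x : ℂ)) x (EuclideanSpace.single j 1) :=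
    hφ'.continuous_fderiv_apply (by simp) |>.comp
      (by fun_prop : Continuous fun x => (x, EuclideanSpace.single j (1 : ℝ)))
  have hfd : ∀ x, fderiv ℝ (fun x => (φ x : ℂ)) x (EuclideanSpace.single j 1) =
      (fderiv ℝ φ x (EuclideanSpace.single j 1) : ℝ) := fun x => by
    have h := Complex.ofRealCLM.hasFDerivAt.comp x (hφ.differentiable (by simp) x).hasFDerivAt
    exact congrArg (fun A : _ →L[ℝ] ℂ => A (EuclideanSpace.single j 1)) h.fderiv
  have h1 := congrArg Complex.re (C.integral_mul_fderiv_of_repr h hφ' hc')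
  rw [Complex.neg_re, ← RCLike.re_to_complex, ← RCLike.re_to_complex,
    ← integral_re (C.integrable_proj_mul hφ'.continuous hc' G),
    ← integral_re (C.integrable_proj_mul hd (hc'.fderiv_apply ℝ _) F)] at h1
  have e1 : ∫ x, (C.reField F).1 x * fderiv ℝ φ x (EuclideanSpace.single j 1) =
      ∫ x, RCLike.re (F (C.proj x) *
        fderiv ℝ (fun x => (φ x : ℂ)) x (EuclideanSpace.single j 1)) := by
    refine integral_congr_ae ?_
    filter_upwards [C.coeFn_reField F] with x hx
    rw [hx, hfd]
    simp
  have e2 : ∫ x, (C.reField G).1 x * φ x = ∫ x, RCLike.re (G (C.proj x) * (φ x : ℂ)) := by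
    refine integral_congr_ae ?_
    filter_upwards [C.coeFn_reField G] with x hx
    rw [hx]
    simp
  rw [e1, e2, h1]

/-- One direction tests with a function isolating the mode `k`. In the other, each term of the
Fourier expansion of the tested divergence vanishes. -/
theorem isDivFree_iff {M : ElasticityTensor d} (s : C.EnergySpace M) :
    C.IsDivFree s ↔ ∀ (i : Fin d) (k : Fin d → ℤ),
      ∑ j, (C.waveForm k (EuclideanSpace.single j 1) : ℂ) *
        (charBasis d).repr (C.toTorus (s.comp i j)) k = 0 := by
  have hcont : ∀ {φ : EuclideanSpace ℝ (Fin d) → ℂ}, ContDiff ℝ ∞ φ → ∀ v,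
      Continuous fun x => fderiv ℝ φ x v := fun hφ v =>
    hφ.continuous_fderiv_apply (by simp) |>.comp (by fun_prop : Continuous fun x => (x, v))
  constructor
  · intro h i k
    obtain ⟨φ, hφ, hc, h1, h2⟩ := C.exists_coefficient_test k
    have key : ∀ T : ℂ →L[ℝ] ℝ,
        T (∑ j, ∫ x, C.toTorus (s.comp i j) (C.proj x) *
          fderiv ℝ φ x (EuclideanSpace.single j 1)) = T 0 := by
      intro T
      rw [map_zero, map_sum, ← h i (fun x => T (φ x)) (T.contDiff.comp hφ)
        (hc.comp_left (map_zero T)), integral_finsetSum]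
      · refine Finset.sum_congr rfl fun j _ => ?_
        rw [C.map_integral_toTorus T _ (hcont hφ _) (hc.fderiv_apply ℝ _)]
        simp only [fderiv_clm_comp T hφ]
        rfl
      · intro j _
        exact integrable_test_deriv (f := s.comp i j) (T.contDiff.comp hφ)
          (hc.comp_left (map_zero T)) _
    have h3 := eq_of_forall_real_clm key
    simp only [h2] at h3
    have h4 : -(2 * Real.pi * Complex.I) *
        ∑ j, (C.waveForm k (EuclideanSpace.single j 1) : ℂ) *
          (charBasis d).repr (C.toTorus (s.comp i j)) k = 0 := by
      rw [← h3, Finset.mul_sum]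
      refine Finset.sum_congr rfl fun j _ => by ring
    refine (mul_eq_zero.1 h4).resolve_left (neg_ne_zero.2 Complex.two_pi_I_ne_zero)
  · intro h i φ hφ hc
    have hφ' : ContDiff ℝ ∞ fun x => (φ x : ℂ) := Complex.ofRealCLM.contDiff.comp hφ
    have hc' : HasCompactSupport fun x => (φ x : ℂ) := hc.comp_left Complex.ofReal_zero
    have hfd : ∀ x v, fderiv ℝ φ x v = Complex.reCLM (fderiv ℝ (fun x => (φ x : ℂ)) x v) :=
      fun x v => fderiv_clm_comp Complex.reCLM hφ' x v
    have hsum : HasSum (fun _ : Fin d → ℤ => (0 : ℂ)) (∑ j, ∫ x, C.toTorus (s.comp i j) (C.proj x) *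
        fderiv ℝ (fun x => (φ x : ℂ)) x (EuclideanSpace.single j 1)) := by
      convert! hasSum_sum (s := Finset.univ) fun j _ =>
        C.hasSum_testFunctional (hcont hφ' (EuclideanSpace.single j 1))
          (hc'.fderiv_apply ℝ _) (C.toTorus (s.comp i j)) using 2 with k
      simp only [C.integral_mFourier_mul_fderiv hφ' hc']
      have h5 : ∀ c : ℂ, ∑ j, (charBasis d).repr (C.toTorus (s.comp i j)) k *
          (-(2 * Real.pi * Complex.I * C.waveForm k (EuclideanSpace.single j 1)) * c) =
          -(2 * Real.pi * Complex.I) * c * ∑ j,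
            (C.waveForm k (EuclideanSpace.single j 1) : ℂ) *
              (charBasis d).repr (C.toTorus (s.comp i j)) k := fun c => by
        rw [Finset.mul_sum]
        exact Finset.sum_congr rfl fun j _ => by ring
      rw [h5, h, mul_zero]
    have h0 := congrArg Complex.reCLM (hsum.unique hasSum_zero)
    rw [map_zero, map_sum] at h0
    rw [← h0, integral_finsetSum]
    · refine Finset.sum_congr rfl fun j _ => ?_
      rw [C.map_integral_toTorus _ _ (hcont hφ' _) (hc'.fderiv_apply ℝ _)]
      simp only [hfd]
      rfl
    · intro j _
      exact integrable_test_deriv (f := s.comp i j) hφ hc _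

end PeriodicCell

namespace ElasticityTensor

/-! ### Bounds for elasticity tensors. -/

variable {d : ℕ}

theorem exists_dcontr_act_le (M : ElasticityTensor d) : ∃ c : ℝ, 0 < c ∧ ∀ e : Tensor2 d,
    dcontr (M.act e) e ≤ c * dcontr e e := by
  -- The summand `1` keeps the constant positive when all coefficients vanish, which happens for `d
  -- = 0`.
  refine ⟨1 + ∑ i, ∑ j, ∑ k, ∑ l, |M.coeff i j k l|, by positivity, fun e => ?_⟩
  have hle : ∀ i j, e i j ^ 2 ≤ dcontr e e := fun i j => by
    simp only [dcontr, ← pow_two]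
    calc e i j ^ 2 ≤ ∑ j, e i j ^ 2 :=
          Finset.single_le_sum (f := fun j => e i j ^ 2) (fun _ _ => sq_nonneg _)
            (Finset.mem_univ j)
      _ ≤ _ := Finset.single_le_sum (f := fun i => ∑ j, e i j ^ 2)
            (fun _ _ => Finset.sum_nonneg fun _ _ => sq_nonneg _) (Finset.mem_univ i)
  have h0 : 0 ≤ dcontr e e :=
    Finset.sum_nonneg fun _ _ => Finset.sum_nonneg fun _ _ => mul_self_nonneg _
  rw [add_mul]
  refine le_add_of_nonneg_of_le (by linarith) ?_
  conv_lhs => simp only [dcontr, act, Finset.sum_mul]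
  simp only [Finset.sum_mul]
  refine Finset.sum_le_sum fun i _ => Finset.sum_le_sum fun j _ => Finset.sum_le_sum fun k _ =>
    Finset.sum_le_sum fun l _ => ?_
  rw [mul_assoc]
  refine (le_abs_self _).trans ?_
  rw [abs_mul]
  refine mul_le_mul_of_nonneg_left ?_ (abs_nonneg _)
  rw [abs_le]
  constructor <;> nlinarith [hle i j, hle k l, sq_nonneg (e k l - e i j), sq_nonneg (e k l + e i j)]

theorem dcontr_sub_smul (M : ElasticityTensor d) (e f : Tensor2 d) (t : ℝ) :
    dcontr (M.act (e - t • f)) (e - t • f) =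
      dcontr (M.act e) e - 2 * t * dcontr (M.act f) e + t ^ 2 * dcontr (M.act f) f := by
  have h1 : M.act (e - t • f) = M.act e - t • M.act f := by
    ext i j
    simp only [act, Pi.sub_apply, Pi.smul_apply, smul_eq_mul, mul_sub, Finset.sum_sub_distrib,
      Finset.mul_sum]
    congr 1
    exact Finset.sum_congr rfl fun _ _ => Finset.sum_congr rfl fun _ _ => by ring
  have h2 : ∀ a b s : Tensor2 d, dcontr (a - t • b) s = dcontr a s - t * dcontr b s :=
    fun a b s => by
      simp only [dcontr, Pi.sub_apply, Pi.smul_apply, smul_eq_mul, sub_mul, Finset.sum_sub_distrib,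
        Finset.mul_sum, mul_assoc]
  rw [h1, h2, dcontr_comm _ (e - t • f), dcontr_comm _ (e - t • f), h2, h2, dcontr_comm e,
    dcontr_comm f, dcontr_comm e, dcontr_comm f, dcontr_act_comm M e f]
  ring

theorem act_symm (M : ElasticityTensor d) (e : Tensor2 d) (i j : Fin d) :
    M.act e i j = M.act e j i := by
  simp only [act, M.minor_left i j]

/-- Uniform coercivity of an elasticity tensor on symmetric tensors. -/
theorem exists_dcontr_le (M : ElasticityTensor d) : ∃ c : ℝ, 0 < c ∧ ∀ e : Tensor2 d,
    (∀ i j, e i j = e j i) → dcontr e e ≤ c * dcontr (M.act e) e := by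
  obtain ⟨c, hc, h⟩ := M.inv.exists_dcontr_act_le
  refine ⟨c, hc, fun e he => ?_⟩
  -- Coercivity comes from the upper bound for `M⁻¹`: in the energy of `e - c⁻¹ M⁻¹ e` the cross
  -- term is `-2 c⁻¹ e : e`, and the last term is at most `c⁻¹ e : e`. No compactness is involved.
  have h1 := PeriodicCell.EnergySpace.act_nonneg M (e - c⁻¹ • M.inv.act e) fun i j => by
    simp [he i j, M.inv.act_symm e i j]
  rw [dcontr_sub_smul, act_inv_act M e he, dcontr_comm e (M.inv.act e)] at h1
  have h2 : c⁻¹ ^ 2 * dcontr (M.inv.act e) e ≤ c⁻¹ * dcontr e e := by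
    calc c⁻¹ ^ 2 * dcontr (M.inv.act e) e ≤ c⁻¹ ^ 2 * (c * dcontr e e) :=
          mul_le_mul_of_nonneg_left (h e) (by positivity)
      _ = _ := by field_simp
  have h3 : c⁻¹ * dcontr e e ≤ dcontr (M.act e) e := by linarith
  calc dcontr e e = c * (c⁻¹ * dcontr e e) := by field_simp
    _ ≤ _ := mul_le_mul_of_nonneg_left h3 hc.le

end ElasticityTensor

namespace PeriodicCell

/-! ### The work pairing and completeness of the energy spaces. -/

variable {d : ℕ} {C : PeriodicCell d}

namespace EnergySpace

variable {M M' : ElasticityTensor d}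

theorem ext_val {η θ : C.EnergySpace M} (h : ∀ᵐ x ∂volume, η.val x = θ.val x) : η = θ := by
  ext1 i j
  refine Subtype.ext (AEEqFun.ext ?_)
  filter_upwards [h] with x hx
  exact congrFun (congrFun hx i) j

theorem coeFn_sum {ι : Type*} (s : Finset ι) (f : ι → C.L2per) :
    ∀ᵐ x ∂volume, (∑ i ∈ s, f i).1 x = ∑ i ∈ s, (f i).1 x := by
  classical
  induction s using Finset.induction_on with
  | empty => exact AEEqFun.coeFn_zero (β := ℝ)
  | insert a s ha ih =>
    filter_upwards [ih, AEEqFun.coeFn_add (f a).1 (∑ i ∈ s, f i).1] with x h1 h2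
    rw [Finset.sum_insert ha, Finset.sum_insert ha, ← h1]
    exact h2

theorem comp_applyTensor (K : ElasticityTensor d) (η : C.EnergySpace M) (i j : Fin d) :
    (η.applyTensor K : C.EnergySpace M').comp i j = ∑ k, ∑ l, K.coeff i j k l • η.comp k l := rfl

theorem val_applyTensor (K : ElasticityTensor d) (η : C.EnergySpace M) :
    ∀ᵐ x ∂volume, (η.applyTensor K : C.EnergySpace M').val x = K.act (η.val x) := by
  have h : ∀ᵐ x ∂volume, ∀ i j, (η.applyTensor K : C.EnergySpace M').val x i j =
      K.act (η.val x) i j := by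
    refine ae_all_iff.2 fun i => ae_all_iff.2 fun j => ?_
    have h1 : ∀ᵐ x ∂volume, ∀ k l, (K.coeff i j k l • η.comp k l).1 x =
        K.coeff i j k l * (η.comp k l).1 x :=
      ae_all_iff.2 fun k => ae_all_iff.2 fun l => AEEqFun.coeFn_smul _ (η.comp k l).1
    have h2 : ∀ᵐ x ∂volume, ∀ k, (∑ l, K.coeff i j k l • η.comp k l).1 x =
        ∑ l, (K.coeff i j k l • η.comp k l).1 x :=
      ae_all_iff.2 fun k => coeFn_sum _ _
    filter_upwards [h1, h2, coeFn_sum Finset.univ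
      fun k => ∑ l, K.coeff i j k l • η.comp k l] with x h1 h2 h3
    simp only [val, comp_applyTensor, h3, h2, h1, ElasticityTensor.act]
  filter_upwards [h] with x hx
  ext i j
  exact hx i j

theorem applyTensor_sub (K : ElasticityTensor d) (η θ : C.EnergySpace M) :
    ((η - θ).applyTensor K : C.EnergySpace M') = η.applyTensor K - θ.applyTensor K := by
  ext1 i j
  have h : ∀ (M : ElasticityTensor d) (η θ : C.EnergySpace M) i j,
    (η - θ).comp i j = η.comp i j - θ.comp i j := fun _ _ _ _ _ => rfl
  simp only [h, comp_applyTensor, smul_sub, Finset.sum_sub_distrib]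

theorem applyTensor_add (K : ElasticityTensor d) (η θ : C.EnergySpace M) :
    ((η + θ).applyTensor K : C.EnergySpace M') = η.applyTensor K + θ.applyTensor K := by
  ext1 i j
  simp only [comp_add, comp_applyTensor, smul_add, Finset.sum_add_distrib]

/-- The average `⟨s : e⟩` of the doubly contracted product of two fields. -/
noncomputable def pairing (s : C.EnergySpace M) (e : C.EnergySpace M') : ℝ :=
  ∑ i, ∑ j, (inner ℂ (C.toTorus (s.comp i j)) (C.toTorus (e.comp i j))).re

theorem pairing_comm (s : C.EnergySpace M) (e : C.EnergySpace M') : pairing s e = pairing e s := by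
  simp only [pairing]
  refine Finset.sum_congr rfl fun i _ => Finset.sum_congr rfl fun j _ => ?_
  rw [← inner_conj_symm, Complex.conj_re]

theorem pairing_add_right (s : C.EnergySpace M) (e f : C.EnergySpace M') :
    pairing s (e + f) = pairing s e + pairing s f := by
  simp only [pairing, comp_add, map_add, inner_add_right, Complex.add_re, Finset.sum_add_distrib]

theorem pairing_eq_setAverage (s : C.EnergySpace M) (e : C.EnergySpace M') :
    pairing s e = ⨍ x in C.cell, dcontr (s.val x) (e.val x) := by
  simp only [pairing, ← setAverage_mul, setAverage_eq, dcontr]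
  rw [integral_finsetSum, Finset.smul_sum]
  · refine Finset.sum_congr rfl fun i _ => ?_
    rw [integral_finsetSum, Finset.smul_sum]
    · rfl
    · exact fun j _ => C.integrable_mul_cell (s.comp i j) (e.comp i j)
  · exact fun i _ => integrable_finsetSum _ fun j _ =>
      C.integrable_mul_cell (s.comp i j) (e.comp i j)

/-- All orthogonality questions are thereby moved to `pairing`, which does not depend on an
elasticity tensor and is computed by Parseval's identity. -/
theorem inner_eq_pairing (η θ : C.EnergySpace M) :
    inner ℝ η θ = pairing (η.applyTensor M : C.EnergySpace M') θ := by
  rw [inner_def, pairing_eq_setAverage, setAverage_eq, setAverage_eq]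
  congr 1
  refine integral_congr_ae (ae_restrict_of_ae ?_)
  filter_upwards [val_applyTensor (M' := M') M η] with x hx
  rw [hx]

theorem pairing_self (η : C.EnergySpace M) :
    pairing η η = ∑ i, ∑ j, ‖C.toTorus (η.comp i j)‖ ^ 2 := by
  refine Finset.sum_congr rfl fun i _ => Finset.sum_congr rfl fun j _ => ?_
  exact inner_self_eq_norm_sq (𝕜 := ℂ) _

theorem integrable_dcontr (η θ : C.EnergySpace M) :
    Integrable (fun x => dcontr (η.val x) (θ.val x)) (volume.restrict C.cell) :=
  integrable_finsetSum _ fun i _ => integrable_finsetSum _ fun j _ =>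
    C.integrable_mul_cell (η.comp i j) (θ.comp i j)

theorem exists_norm_sq_le (C : PeriodicCell d) (M : ElasticityTensor d) : ∃ c : ℝ, 0 < c ∧
    ∀ η : C.EnergySpace M, ‖η‖ ^ 2 ≤ c * pairing η η := by
  obtain ⟨c, hc, h⟩ := M.exists_dcontr_act_le
  refine ⟨c, hc, fun η => ?_⟩
  rw [← real_inner_self_eq_norm_sq, inner_def, pairing_eq_setAverage, setAverage_eq,
    setAverage_eq, smul_eq_mul, smul_eq_mul, mul_left_comm c, ← integral_const_mul c]
  exact mul_le_mul_of_nonneg_left (integral_mono (integrable_energy η η)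
    ((integrable_dcontr η η).const_mul c) fun x => h _) (by positivity)

theorem exists_pairing_self_le (C : PeriodicCell d) (M : ElasticityTensor d) : ∃ c : ℝ, 0 < c ∧
    ∀ η : C.EnergySpace M, pairing η η ≤ c * ‖η‖ ^ 2 := by
  obtain ⟨c, hc, h⟩ := M.exists_dcontr_le
  refine ⟨c, hc, fun η => ?_⟩
  rw [← real_inner_self_eq_norm_sq, inner_def, pairing_eq_setAverage, setAverage_eq,
    setAverage_eq, smul_eq_mul, smul_eq_mul, mul_left_comm c, ← integral_const_mul c]
  exact mul_le_mul_of_nonneg_left (integral_mono (integrable_dcontr η η)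
    ((integrable_energy η η).const_mul c) fun x => h _ (η.val_symm x)) (by positivity)

/-- The components of a tensor field, as functions on the torus. -/
noncomputable def torusComp (i j : Fin d) : C.EnergySpace M →L[ℝ] TorusL2 d :=
  LinearMap.mkContinuousOfExistsBound
    { toFun := fun η => C.toTorus (η.comp i j)
      map_add' := fun η θ => by rw [comp_add, map_add]
      map_smul' := fun c η => by rw [comp_smul, map_smul, RingHom.id_apply] }
    (by
      obtain ⟨c, hc, h⟩ := exists_pairing_self_le C M
      refine ⟨√c, fun η => ?_⟩
      change ‖C.toTorus (η.comp i j)‖ ≤ _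
      refine le_of_sq_le_sq ?_ (by positivity)
      rw [mul_pow, Real.sq_sqrt hc.le]
      refine le_trans ?_ (h η)
      rw [pairing_self]
      calc ‖C.toTorus (η.comp i j)‖ ^ 2 ≤ ∑ j, ‖C.toTorus (η.comp i j)‖ ^ 2 :=
            Finset.single_le_sum (f := fun j => ‖C.toTorus (η.comp i j)‖ ^ 2)
              (fun _ _ => sq_nonneg _) (Finset.mem_univ j)
        _ ≤ _ := Finset.single_le_sum (f := fun i => ∑ j, ‖C.toTorus (η.comp i j)‖ ^ 2)
              (fun _ _ => Finset.sum_nonneg fun _ _ => sq_nonneg _) (Finset.mem_univ i))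

theorem torusComp_apply (i j : Fin d) (η : C.EnergySpace M) :
    torusComp i j η = C.toTorus (η.comp i j) := rfl

/-- The components of a Cauchy sequence converge on the torus. The real parts of the limits form a
symmetric field, and the equivalence of norms gives convergence to it in energy. -/
instance : CompleteSpace (C.EnergySpace M) := by
  refine Metric.complete_of_cauchySeq_tendsto fun u hu => ?_
  have hF : ∀ i j, ∃ F, Filter.Tendsto (fun n => torusComp i j (u n)) Filter.atTop (nhds F) :=
    fun i j => cauchySeq_tendsto_of_complete
      (hu.map (torusComp (C := C) (M := M) i j).uniformContinuous)
  choose F hF using hF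
  have hsymm : ∀ i j, F i j = F j i := fun i j => by
    refine tendsto_nhds_unique (hF i j) ((hF j i).congr fun n => ?_)
    rw [torusComp_apply, torusComp_apply, comp_symm]
  let η : C.EnergySpace M := ⟨fun i j => C.reField (F i j), fun i j => congrArg C.reField (hsymm i j)⟩
  obtain ⟨c, hc, h⟩ := exists_norm_sq_le C M
  refine ⟨η, tendsto_iff_norm_sub_tendsto_zero.2 ?_⟩
  have hlim : Filter.Tendsto (fun n => √(c * ∑ i, ∑ j, ‖F i j - torusComp i j (u n)‖ ^ 2))
      Filter.atTop (nhds 0) := by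
    have h1 : ∀ i j, Filter.Tendsto (fun n => ‖F i j - torusComp i j (u n)‖ ^ 2)
        Filter.atTop (nhds 0) := fun i j => by
      have := (((hF i j).const_sub (F i j)).norm.pow 2)
      simpa using this
    have h2 := ((tendsto_finsetSum Finset.univ fun i _ =>
      tendsto_finsetSum Finset.univ fun j _ => h1 i j).const_mul c).sqrt
    simpa using h2
  refine squeeze_zero (fun _ => norm_nonneg _) (fun n => Real.le_sqrt_of_sq_le ?_) hlim
  rw [norm_sub_rev]
  refine (h _).trans (mul_le_mul_of_nonneg_left ?_ hc.le)
  rw [pairing_self]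
  refine Finset.sum_le_sum fun i _ => Finset.sum_le_sum fun j _ => ?_
  gcongr
  exact C.norm_toTorus_reField_sub_le (F i j) ((u n).comp i j)

end EnergySpace

end PeriodicCell

namespace PeriodicCell

/-! ### Compatible fields mode by mode, and their duality with divergence-free fields. -/

variable {d : ℕ} (C : PeriodicCell d)

/-- The components of the wave vector of index `k`. -/
noncomputable def freq (k : Fin d → ℤ) (j : Fin d) : ℝ := C.waveForm k (EuclideanSpace.single j 1)

theorem freq_zero (j : Fin d) : C.freq 0 j = 0 := by
  simp [freq, waveForm_apply]

theorem waveForm_eq_sum (k : Fin d → ℤ) (x : EuclideanSpace ℝ (Fin d)) :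
    C.waveForm k x = ∑ j, x j * C.freq k j := by
  conv_lhs => rw [← (EuclideanSpace.basisFun (Fin d) ℝ).sum_repr x]
  simp [freq, map_sum]

/-- Nonzero wave vectors are bounded away from zero. -/
theorem exists_one_le_freq_sq : ∃ B : ℝ, 0 ≤ B ∧ ∀ k : Fin d → ℤ, k ≠ 0 →
    1 ≤ B * ∑ j, C.freq k j ^ 2 := by
  -- The wave vector of `k` has scalar product `k m` with the `m`-th lattice vector. This is an
  -- integer, nonzero for some `m`, and Cauchy–Schwarz applies; summing over all `m` makes the
  -- constant independent of `k`.
  refine ⟨∑ m, ∑ j, (C.vec m) j ^ 2, by positivity, fun k hk => ?_⟩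
  obtain ⟨m, hm⟩ := Function.ne_iff.1 hk
  have h1 : (k m : ℝ) = ∑ j, (C.vec m) j * C.freq k j := by
    rw [← waveForm_eq_sum, waveForm_apply]
    simp [Finsupp.single_apply]
  have h2 : (1 : ℝ) ≤ (k m : ℝ) ^ 2 := by
    have : (1 : ℤ) ≤ (k m) ^ 2 := Int.add_one_le_iff.2 (sq_pos_of_ne_zero hm)
    exact_mod_cast this
  have hS : 0 ≤ ∑ j, C.freq k j ^ 2 := Finset.sum_nonneg fun _ _ => sq_nonneg _
  calc (1 : ℝ) ≤ (∑ j, (C.vec m) j * C.freq k j) ^ 2 := by rwa [← h1]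
    _ ≤ (∑ j, (C.vec m) j ^ 2) * ∑ j, C.freq k j ^ 2 := Finset.sum_mul_sq_le_sq_mul_sq _ _ _
    _ ≤ _ := by
        refine mul_le_mul_of_nonneg_right ?_ hS
        exact Finset.single_le_sum (f := fun m => ∑ j, (C.vec m) j ^ 2)
          (fun _ _ => Finset.sum_nonneg fun _ _ => sq_nonneg _) (Finset.mem_univ m)

/-- The symmetrized tensor product `a ↦ (a ⊗ ξ + ξ ⊗ a) / 2`. -/
noncomputable def symProd (ξ : Fin d → ℝ) : (Fin d → ℂ) →ₗ[ℂ] Fin d → Fin d → ℂ where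
  toFun a i j := (ξ j * a i + ξ i * a j) / 2
  map_add' a b := by
    ext i j
    simp only [Pi.add_apply]
    ring
  map_smul' c a := by
    ext i j
    simp only [Pi.smul_apply, smul_eq_mul, RingHom.id_apply]
    ring

theorem symProd_apply (ξ : Fin d → ℝ) (a : Fin d → ℂ) (i j : Fin d) :
    symProd ξ a i j = (ξ j * a i + ξ i * a j) / 2 := rfl

/-- Korn's inequality for a single Fourier mode. -/
theorem sum_sq_mul_sum_sq_le (ξ : Fin d → ℝ) (a : Fin d → ℂ) :
    (∑ j, ξ j ^ 2) * ∑ i, ‖a i‖ ^ 2 ≤ 2 * ∑ i, ∑ j, ‖symProd ξ a i j‖ ^ 2 := by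
  have h : ∀ i j, ‖symProd ξ a i j‖ ^ 2 = (ξ j ^ 2 * ‖a i‖ ^ 2 + ξ i ^ 2 * ‖a j‖ ^ 2) / 4 +
      (ξ i * (a i).re * (ξ j * (a j).re) + ξ i * (a i).im * (ξ j * (a j).im)) / 2 := by
    intro i j
    simp only [symProd_apply, ← Complex.normSq_eq_norm_sq, Complex.normSq_apply, Complex.div_ofNat_re,
      Complex.div_ofNat_im, Complex.add_re, Complex.add_im, Complex.re_ofReal_mul,
      Complex.im_ofReal_mul]
    ring
  -- The excess over half of `|ξ|² |a|²` is `|ξ · a|² / 2`, which is nonnegative.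
  have h2 : ∑ i, ∑ j, ‖symProd ξ a i j‖ ^ 2 = ((∑ j, ξ j ^ 2) * ∑ i, ‖a i‖ ^ 2) / 2 +
      ((∑ i, ξ i * (a i).re) ^ 2 + (∑ i, ξ i * (a i).im) ^ 2) / 2 := by
    simp only [h, Finset.sum_add_distrib, ← Finset.sum_div, ← Finset.mul_sum, ← Finset.sum_mul]
    ring
  rw [h2]
  nlinarith [sq_nonneg (∑ i, ξ i * (a i).re), sq_nonneg (∑ i, ξ i * (a i).im)]

variable {C}
variable {M M' : ElasticityTensor d}

/-- The Fourier coefficients of a tensor field. -/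
noncomputable def tensorCoeff (k : Fin d → ℤ) (e : C.EnergySpace M) : Fin d → Fin d → ℂ :=
  fun i j => (charBasis d).repr (C.toTorus (e.comp i j)) k

theorem continuous_tensorCoeff (k : Fin d → ℤ) :
    Continuous (tensorCoeff k : C.EnergySpace M → Fin d → Fin d → ℂ) := by
  refine continuous_pi fun i => continuous_pi fun j => ?_
  have h : ∀ e : C.EnergySpace M, tensorCoeff k e i j =
      inner ℂ (charBasis d k) (EnergySpace.torusComp i j e) := fun e =>
    (charBasis d).repr_apply_apply _ _
  simp only [h]
  exact (continuous_const.inner (EnergySpace.torusComp i j).continuous)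

theorem tensorCoeff_mem_of_mem_compatibleFields {e : C.EnergySpace M}
    (he : e ∈ C.compatibleFields M) (k : Fin d → ℤ) :
    tensorCoeff k e ∈ LinearMap.range (symProd (C.freq k)) := by
  obtain ⟨w, G, hw, he⟩ := he
  refine ⟨fun i => 2 * Real.pi * Complex.I * (charBasis d).repr (C.toTorus (w i)) k, ?_⟩
  ext i j
  have h := fun i j => (hw i j).repr_eq C k
  have h2 : tensorCoeff k e i j = (1 / 2 : ℂ) * ((charBasis d).repr (C.toTorus (G i j)) k +
      (charBasis d).repr (C.toTorus (G j i)) k) := by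
    rw [tensorCoeff, he, map_smul, map_add]
    have h3 : ∀ F : TorusL2 d, (charBasis d).repr ((1 / 2 : ℝ) • F) k =
        (1 / 2 : ℂ) * (charBasis d).repr F k := fun F => by
      rw [← algebraMap_smul ℂ (1 / 2 : ℝ) F, map_smul]
      simp
    rw [h3, map_add]
    rfl
  rw [h2, h, h, symProd_apply, freq, freq]
  ring

theorem memℓp_of_norm_sq_le {ι κ : Type*} {a : κ → ℂ} (s : Finset ι) (F : ι → lp (fun _ : κ => ℂ) 2)
    (c : ℝ) (h : ∀ k, ‖a k‖ ^ 2 ≤ c * ∑ i ∈ s, ‖F i k‖ ^ 2) : Memℓp a 2 := by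
  have hF : ∀ i, Summable fun k => ‖F i k‖ ^ 2 := fun i => by
    have := (memℓp_gen_iff (by norm_num)).1 (lp.memℓp (F i))
    simpa using this
  refine memℓp_gen ?_
  simp only [ENNReal.toReal_ofNat, Real.rpow_ofNat]
  exact Summable.of_nonneg_of_le (fun _ => sq_nonneg _) h
    ((summable_sum fun i _ => hF i).mul_left c)

theorem exists_repr_eq {a : (Fin d → ℤ) → ℂ} (ha : Memℓp a 2) :
    ∃ F : TorusL2 d, ∀ k, (charBasis d).repr F k = a k :=
  ⟨(charBasis d).repr.symm ⟨a, ha⟩, fun k => by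
    rw [LinearIsometryEquiv.apply_symm_apply]⟩

theorem ext_repr {F G : TorusL2 d} (h : ∀ k, (charBasis d).repr F k = (charBasis d).repr G k) :
    F = G :=
  (charBasis d).repr.injective (lp.ext (funext h))

theorem reField_half_add (F G : TorusL2 d) (f : C.L2per)
    (h : C.toTorus f = (1 / 2 : ℂ) • (F + G)) :
    f = (1 / 2 : ℝ) • (C.reField F + C.reField G) := by
  refine Subtype.ext (AEEqFun.ext ?_)
  have h1 := C.quasiMeasurePreserving_proj.ae (Lp.coeFn_smul (1 / 2 : ℂ) (F + G))
  have h2 := C.quasiMeasurePreserving_proj.ae (Lp.coeFn_add F G)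
  have h3 := AEEqFun.coeFn_smul (1 / 2 : ℝ) (C.reField F + C.reField G).1
  have h4 := AEEqFun.coeFn_add (C.reField F).1 (C.reField G).1
  filter_upwards [C.toTorus_proj f, h1, h2, h3, h4, C.coeFn_reField F, C.coeFn_reField G]
    with x h0 h1 h2 h3 h4 h5 h6
  rw [h, h1, Pi.smul_apply, h2, Pi.add_apply] at h0
  have h7 : ((1 / 2 : ℝ) • (C.reField F + C.reField G)).1 x =
      (1 / 2 : ℝ) * ((F (C.proj x)).re + (G (C.proj x)).re) := by
    rw [← h5, ← h6]
    refine h3.trans ?_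
    rw [Pi.smul_apply, smul_eq_mul]
    congr 1
  rw [h7]
  have h8 := congrArg Complex.re h0
  simpa using h8.symm

/-- For the converse, the amplitudes `a k` are the Fourier coefficients of the displacement up to
the factor `2πi`. Korn's inequality in each mode makes the gradient coefficients square-summable,
and the lower bound on nonzero wave vectors then does the same for the displacement. -/
theorem mem_compatibleFields_iff {e : C.EnergySpace M} : e ∈ C.compatibleFields M ↔
    ∀ k, tensorCoeff k e ∈ LinearMap.range (symProd (C.freq k)) := by
  refine ⟨tensorCoeff_mem_of_mem_compatibleFields, fun h => ?_⟩
  choose a₀ ha₀ using h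
  -- At `k = 0` the wave vector vanishes, so Korn's inequality does not control the amplitude. It
  -- also does not influence the strain, and can be set to zero.
  let a : (Fin d → ℤ) → Fin d → ℂ := fun k => if k = 0 then 0 else a₀ k
  have ha : ∀ k, symProd (C.freq k) (a k) = tensorCoeff k e := by
    intro k
    by_cases hk : k = 0
    · rw [← ha₀ k]
      ext i j
      simp [symProd_apply, hk, freq_zero]
    · simp only [a, hk, if_false, ha₀]
  let N : (Fin d → ℤ) → ℝ := fun k => ∑ p : Fin d × Fin d,
    ‖(charBasis d).repr (C.toTorus (e.comp p.1 p.2)) k‖ ^ 2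
  have hkorn : ∀ k, (∑ j, C.freq k j ^ 2) * ∑ i, ‖a k i‖ ^ 2 ≤ 2 * N k := by
    intro k
    refine (sum_sq_mul_sum_sq_le (C.freq k) (a k)).trans_eq ?_
    rw [ha]
    simp only [N, Fintype.sum_prod_type, tensorCoeff]
  have hai : ∀ k i, ‖a k i‖ ^ 2 ≤ ∑ i, ‖a k i‖ ^ 2 := fun k i =>
    Finset.single_le_sum (f := fun i => ‖a k i‖ ^ 2) (fun _ _ => sq_nonneg _) (Finset.mem_univ i)
  have hG : ∀ i j, Memℓp (fun k => (C.freq k j : ℂ) * a k i) 2 := fun i j => by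
    refine memℓp_of_norm_sq_le Finset.univ
      (fun p : Fin d × Fin d => (charBasis d).repr (C.toTorus (e.comp p.1 p.2))) 2 fun k => ?_
    refine le_trans ?_ (hkorn k)
    rw [norm_mul, mul_pow, Complex.norm_real, Real.norm_eq_abs, sq_abs]
    have hfj : C.freq k j ^ 2 ≤ ∑ j, C.freq k j ^ 2 :=
      Finset.single_le_sum (f := fun j => C.freq k j ^ 2) (fun _ _ => sq_nonneg _)
        (Finset.mem_univ j)
    exact mul_le_mul hfj (hai k i) (sq_nonneg _) ((sq_nonneg _).trans hfj)
  obtain ⟨B, hB, hfreq⟩ := C.exists_one_le_freq_sq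
  have hw : ∀ i, Memℓp (fun k => a k i) 2 := fun i => by
    refine memℓp_of_norm_sq_le Finset.univ
      (fun p : Fin d × Fin d => (charBasis d).repr (C.toTorus (e.comp p.1 p.2)))
      (B * 2) fun k => ?_
    by_cases hk : k = 0
    · have : a k i = 0 := by simp [a, hk]
      rw [this, norm_zero, zero_pow two_ne_zero]
      positivity
    · have h0 : (0 : ℝ) ≤ ∑ i, ‖a k i‖ ^ 2 := Finset.sum_nonneg fun _ _ => sq_nonneg _
      calc ‖a k i‖ ^ 2 ≤ 1 * ∑ i, ‖a k i‖ ^ 2 := by rw [one_mul]; exact hai k i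
        _ ≤ (B * ∑ j, C.freq k j ^ 2) * ∑ i, ‖a k i‖ ^ 2 :=
          mul_le_mul_of_nonneg_right (hfreq k hk) h0
        _ = B * ((∑ j, C.freq k j ^ 2) * ∑ i, ‖a k i‖ ^ 2) := mul_assoc _ _ _
        _ ≤ B * (2 * N k) := mul_le_mul_of_nonneg_left (hkorn k) hB
        _ = _ := (mul_assoc _ _ _).symm
  choose w hw using fun i => exists_repr_eq (hw i)
  choose G hG using fun i j => exists_repr_eq (hG i j)
  -- The chosen amplitudes need not have conjugate symmetry. Real parts are harmless because `e` is
  -- real.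
  refine ⟨fun i => C.reField ((2 * Real.pi * Complex.I : ℂ)⁻¹ • w i),
    fun i j => C.reField (G i j),
    fun i j => C.isWeakPartial_reField fun k => ?_, fun i j => reField_half_add _ _ _ ?_⟩
  · rw [map_smul, lp.coeFn_smul, Pi.smul_apply, smul_eq_mul, hw, hG, ← freq]
    have := Complex.two_pi_I_ne_zero
    field_simp
  · refine ext_repr fun k => ?_
    have h1 := congrFun (congrFun (ha k) i) j
    rw [symProd_apply, tensorCoeff] at h1
    rw [← h1, map_smul, map_add]
    simp only [lp.coeFn_smul, lp.coeFn_add, Pi.smul_apply, Pi.add_apply, hG, smul_eq_mul]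
    ring

/-- By the mode-wise criterion the set is an intersection of preimages of finite-dimensional
subspaces under continuous maps. -/
theorem isClosed_compatibleFields :
    IsClosed (C.compatibleFields M : Set (C.EnergySpace M)) := by
  have h : (C.compatibleFields M : Set (C.EnergySpace M)) =
      ⋂ k, tensorCoeff k ⁻¹' (LinearMap.range (symProd (C.freq k)) : Set (Fin d → Fin d → ℂ)) := by
    ext e
    simp only [SetLike.mem_coe, mem_compatibleFields_iff, Set.mem_iInter, Set.mem_preimage]
  rw [h]
  exact isClosed_iInter fun k =>
    (Submodule.closed_of_finiteDimensional _).preimage (continuous_tensorCoeff k)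

/-- Divergence-free fields do no work on compatible fields. -/
theorem pairing_eq_zero_of_isDivFree {s : C.EnergySpace M} (hs : C.IsDivFree s)
    {e : C.EnergySpace M'} (he : e ∈ C.compatibleFields M') : EnergySpace.pairing s e = 0 := by
  rw [isDivFree_iff] at hs
  -- Parseval's identity. Each mode vanishes: `ŝ(k)` annihilates `a ⊗ ξ` by zero divergence, and `ξ
  -- ⊗ a` by symmetry.
  have hsum : HasSum (fun k => ∑ i, ∑ j, starRingEnd ℂ (tensorCoeff k s i j) * tensorCoeff k e i j)
      (∑ i, ∑ j, inner ℂ (C.toTorus (s.comp i j)) (C.toTorus (e.comp i j))) := by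
    refine hasSum_sum fun i _ => hasSum_sum fun j _ => ?_
    have h := (charBasis d).hasSum_inner_mul_inner (C.toTorus (s.comp i j)) (C.toTorus (e.comp i j))
    simp only [← inner_conj_symm (C.toTorus (s.comp i j)) (charBasis d _),
      ← HilbertBasis.repr_apply_apply] at h
    exact h
  have hzero : ∀ k, ∑ i, ∑ j, starRingEnd ℂ (tensorCoeff k s i j) * tensorCoeff k e i j = 0 := by
    intro k
    obtain ⟨a, ha⟩ := tensorCoeff_mem_of_mem_compatibleFields he k
    have h1 : ∀ i, ∑ j, starRingEnd ℂ (tensorCoeff k s i j) * (C.freq k j * a i) = 0 := by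
      intro i
      have h2 := congrArg (starRingEnd ℂ) (hs i k)
      simp only [map_sum, map_mul, Complex.conj_ofReal, map_zero] at h2
      calc _ = (∑ j, (C.freq k j : ℂ) * starRingEnd ℂ (tensorCoeff k s i j)) * a i := by
            rw [Finset.sum_mul]
            exact Finset.sum_congr rfl fun j _ => by ring
        _ = 0 := by rw [show (∑ j, (C.freq k j : ℂ) * starRingEnd ℂ (tensorCoeff k s i j)) = 0
              from h2, zero_mul]
    have h3 : ∑ i, ∑ j, starRingEnd ℂ (tensorCoeff k s i j) * (C.freq k i * a j) = 0 := by
      rw [Finset.sum_comm]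
      refine Finset.sum_eq_zero fun j _ => (Finset.sum_congr rfl fun i _ => ?_).trans (h1 j)
      simp only [tensorCoeff, s.comp_symm i j]
    have h4 : ∑ i, ∑ j, starRingEnd ℂ (tensorCoeff k s i j) * (C.freq k j * a i) = 0 :=
      Finset.sum_eq_zero fun i _ => h1 i
    calc _ = (∑ i, ∑ j, starRingEnd ℂ (tensorCoeff k s i j) * (C.freq k j * a i) +
          ∑ i, ∑ j, starRingEnd ℂ (tensorCoeff k s i j) * (C.freq k i * a j)) / 2 := by
          simp only [← Finset.sum_add_distrib, Finset.sum_div, ← ha, symProd_apply]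
          exact Finset.sum_congr rfl fun i _ => Finset.sum_congr rfl fun j _ => by ring
      _ = 0 := by rw [h3, h4, add_zero, zero_div]
  simp only [hzero] at hsum
  have := congrArg Complex.re (hsum.unique hasSum_zero)
  simpa [EnergySpace.pairing] using this

/-- The fields that do no work on compatible fields are divergence-free. -/
theorem isDivFree_of_pairing_eq_zero (M' : ElasticityTensor d) {s : C.EnergySpace M}
    (h : ∀ e ∈ C.compatibleFields M', EnergySpace.pairing s e = 0) : C.IsDivFree s := by
  rw [isDivFree_iff]
  intro i₀ k
  set z : ℂ := ∑ j, (C.waveForm k (EuclideanSpace.single j 1) : ℂ) *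
    (charBasis d).repr (C.toTorus (s.comp i₀ j)) k with hz
  -- The compatible test field has a single mode whose amplitude is the divergence coefficient `z`
  -- itself, so that its pairing with `s` is `|z|²`.
  let b : Fin d → ℂ := fun i => if i = i₀ then z else 0
  let w : Fin d → TorusL2 d := fun i => ((2 * Real.pi * Complex.I)⁻¹ * b i) • charBasis d k
  let G : Fin d → Fin d → TorusL2 d := fun i j => ((C.freq k j : ℂ) * b i) • charBasis d k
  let e : C.EnergySpace M' :=
    ⟨fun i j => (1 / 2 : ℝ) • (C.reField (G i j) + C.reField (G j i)),
      fun i j => congrArg ((1 / 2 : ℝ) • ·) (add_comm _ _)⟩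
  have hrepr : ∀ (c : ℂ) m, (charBasis d).repr (c • charBasis d k) m = if m = k then c else 0 := by
    intro c m
    rw [map_smul, HilbertBasis.repr_self, lp.coeFn_smul, Pi.smul_apply, lp.single_apply]
    by_cases hm : m = k
    · subst hm; simp
    · simp [hm]
  have he : e ∈ C.compatibleFields M' := by
    refine ⟨fun i => C.reField (w i), fun i j => C.reField (G i j),
      fun i j => C.isWeakPartial_reField fun m => ?_, fun i j => rfl⟩
    rw [hrepr, hrepr]
    split_ifs with hm
    · subst hm
      have := Complex.two_pi_I_ne_zero
      rw [← freq]
      field_simp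
    · rw [mul_zero]
  have hS : ∀ i j, (inner ℂ (C.toTorus (s.comp i j)) (C.toTorus (e.comp i j))).re =
      ((inner ℂ (C.toTorus (s.comp i j)) (G i j)).re +
        (inner ℂ (C.toTorus (s.comp i j)) (G j i)).re) / 2 := by
    intro i j
    change (inner ℂ (C.toTorus (s.comp i j))
      (C.toTorus ((1 / 2 : ℝ) • (C.reField (G i j) + C.reField (G j i))))).re = _
    rw [map_smul, map_add, ← algebraMap_smul ℂ (1 / 2 : ℝ), inner_smul_right, inner_add_right,
      ← C.setAverage_mul_reField, ← C.setAverage_mul_reField, C.setAverage_mul, C.setAverage_mul]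
    simp
    ring
  have hT : ∑ i, ∑ j, (inner ℂ (C.toTorus (s.comp i j)) (G j i)).re =
      ∑ i, ∑ j, (inner ℂ (C.toTorus (s.comp i j)) (G i j)).re := by
    rw [Finset.sum_comm]
    refine Finset.sum_congr rfl fun i _ => Finset.sum_congr rfl fun j _ => ?_
    rw [s.comp_symm]
  have hp : EnergySpace.pairing s e =
      ∑ i, ∑ j, (inner ℂ (C.toTorus (s.comp i j)) (G i j)).re := by
    rw [EnergySpace.pairing]
    simp only [hS, ← Finset.sum_div, Finset.sum_add_distrib, hT]
    ring
  have hin : ∀ i j, inner ℂ (C.toTorus (s.comp i j)) (G i j) =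
      C.freq k j * b i * starRingEnd ℂ ((charBasis d).repr (C.toTorus (s.comp i j)) k) := by
    intro i j
    rw [inner_smul_right, HilbertBasis.repr_apply_apply, inner_conj_symm]
  have hfin : ∑ i, ∑ j, inner ℂ (C.toTorus (s.comp i j)) (G i j) = z * starRingEnd ℂ z := by
    rw [Finset.sum_eq_single i₀]
    · conv_rhs => rw [hz]
      rw [map_sum, Finset.mul_sum]
      refine Finset.sum_congr rfl fun j _ => ?_
      rw [hin, map_mul, Complex.conj_ofReal, ← freq]
      simp only [b, if_true]
      rw [← hz]
      ring
    · intro i _ hi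
      refine Finset.sum_eq_zero fun j _ => ?_
      rw [hin]
      simp [b, hi]
    · simp
  have hre := h e he
  rw [hp] at hre
  simp only [← Complex.re_sum] at hre
  rw [hfin, Complex.mul_conj, Complex.ofReal_re, Complex.normSq_eq_zero] at hre
  exact hre

end PeriodicCell

/-- The two memberships supply the projection themselves: neither linearity of `P` nor completeness
of `K` has to be known beforehand. -/
theorem isOrthogonalProjector_of_mem {H : Type*} [NormedAddCommGroup H] [InnerProductSpace ℝ H]
    {K : Submodule ℝ H} {P : H → H} (hP : ∀ η, P η ∈ K) (hP' : ∀ η, η - P η ∈ Kᗮ) :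
    IsOrthogonalProjector K P := by
  have : K.HasOrthogonalProjection := ⟨fun η => ⟨P η, hP η, hP' η⟩⟩
  exact ⟨this, fun η => (Submodule.eq_starProjection_of_mem_orthogonal (hP η) (hP' η))⟩

namespace PeriodicCell

/-! ### Averages and uniform fields. -/

variable {d : ℕ} {C : PeriodicCell d}

theorem constField_eq_smul (c : ℝ) : C.constField c = c • C.constField 1 := by
  refine Subtype.ext (AEEqFun.ext ?_)
  have h1 := AEEqFun.coeFn_const (μ := (volume : Measure (EuclideanSpace ℝ (Fin d)))) _ c
  have h2 := AEEqFun.coeFn_const (μ := (volume : Measure (EuclideanSpace ℝ (Fin d)))) _ (1 : ℝ)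
  have h3 := AEEqFun.coeFn_smul c (C.constField 1).1
  filter_upwards [h1, h2, h3] with x h1 h2 h3
  refine h1.trans (Eq.symm (h3.trans ?_))
  rw [Pi.smul_apply, smul_eq_mul]
  change c * (AEEqFun.const _ (1 : ℝ) : _ →ₘ[volume] ℝ) x = _
  rw [h2]
  simp

theorem toTorus_constField (c : ℝ) : C.toTorus (C.constField c) = (c : ℂ) • charBasis d 0 := by
  have h1 := AEEqFun.coeFn_const (μ := (volume : Measure (EuclideanSpace ℝ (Fin d)))) _ c
  refine Lp.ext ?_
  filter_upwards [C.coeFn_toTorus (C.constField c), C.quasiMeasurePreserving_lift.ae h1,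
    Lp.coeFn_smul (c : ℂ) (charBasis d 0), coeFn_charBasis (d := d) 0] with t h2 h3 h4 h5
  rw [h2, h4, Pi.smul_apply, h5, UnitAddTorus.mFourier_zero]
  change (((AEEqFun.const _ c : _ →ₘ[volume] ℝ) (C.lift t) : ℝ) : ℂ) = _
  rw [h3]
  simp

/-- The average over the cell of a periodic function, as a linear functional. -/
noncomputable def average : C.L2per →ₗ[ℝ] ℝ where
  toFun f := (inner ℂ (C.toTorus (C.constField 1)) (C.toTorus f)).re
  map_add' f g := by rw [map_add, inner_add_right, Complex.add_re]
  map_smul' c f := by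
    rw [map_smul, ← algebraMap_smul ℂ c, inner_smul_right]
    simp

theorem setAverage_eq_average (f : C.L2per) : ⨍ x in C.cell, f.1 x = average f := by
  change _ = (inner ℂ (C.toTorus (C.constField 1)) (C.toTorus f)).re
  rw [← setAverage_mul, setAverage_eq, setAverage_eq]
  congr 1
  refine integral_congr_ae (ae_restrict_of_ae ?_)
  have h2 := AEEqFun.coeFn_const (μ := (volume : Measure (EuclideanSpace ℝ (Fin d)))) _ (1 : ℝ)
  filter_upwards [h2] with x hx
  change _ = (AEEqFun.const _ (1 : ℝ) : _ →ₘ[volume] ℝ) x * _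
  rw [hx]
  simp

theorem average_constField (c : ℝ) : average (C.constField c) = c := by
  change (inner ℂ (C.toTorus (C.constField 1)) (C.toTorus (C.constField c))).re = c
  rw [toTorus_constField, toTorus_constField, inner_smul_right, inner_smul_left,
    inner_self_eq_norm_sq_to_K, (charBasis d).orthonormal.1]
  simp

namespace EnergySpace

variable {M M' : ElasticityTensor d}

theorem setAverage_val (η : C.EnergySpace M) (i j : Fin d) :
    ⨍ x in C.cell, η.val x i j = average (η.comp i j) := setAverage_eq_average _

theorem comp_mean (η : C.EnergySpace M) (i j : Fin d) :
    η.mean.comp i j = C.constField (average (η.comp i j)) :=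
  congrArg C.constField (setAverage_val η i j)

theorem average_mean (η : C.EnergySpace M) (i j : Fin d) :
    average (η.mean.comp i j) = average (η.comp i j) := by
  rw [comp_mean, average_constField]

theorem comp_sub (η θ : C.EnergySpace M) (i j : Fin d) :
    (η - θ).comp i j = η.comp i j - θ.comp i j := rfl

theorem mean_mem (η : C.EnergySpace M) : η.mean ∈ C.uniformFields M := ⟨_, _, rfl⟩

theorem average_sub_mean (η : C.EnergySpace M) (i j : Fin d) :
    average ((η - η.mean).comp i j) = 0 := by
  rw [comp_sub, map_sub, average_mean, sub_self]

theorem average_applyTensor (K : ElasticityTensor d) (η : C.EnergySpace M) (i j : Fin d) :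
    average ((η.applyTensor K : C.EnergySpace M').comp i j) =
      ∑ k, ∑ l, K.coeff i j k l * average (η.comp k l) := by
  simp only [comp_applyTensor, map_sum, map_smul, smul_eq_mul]

theorem mean_applyTensor (K : ElasticityTensor d) (η : C.EnergySpace M) :
    (η.applyTensor K : C.EnergySpace M').mean = η.mean.applyTensor K := by
  ext1 i j
  rw [comp_mean, average_applyTensor, comp_applyTensor, constField_eq_smul]
  simp only [comp_mean, Finset.sum_smul]
  refine Finset.sum_congr rfl fun k _ => Finset.sum_congr rfl fun l _ => ?_
  rw [constField_eq_smul (average _), smul_smul]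

theorem applyTensor_mem_uniformFields (K : ElasticityTensor d) {η : C.EnergySpace M}
    (h : η ∈ C.uniformFields M) :
    (η.applyTensor K : C.EnergySpace M') ∈ C.uniformFields M' := by
  obtain ⟨A, hA, rfl⟩ := h
  refine ⟨K.act A, K.act_symm A, ?_⟩
  ext1 i j
  rw [comp_applyTensor]
  change _ = C.constField (K.act A i j)
  rw [constField_eq_smul]
  simp only [ElasticityTensor.act, Finset.sum_smul]
  refine Finset.sum_congr rfl fun k _ => Finset.sum_congr rfl fun l _ => ?_
  change _ • C.constField (A k l) = _
  rw [constField_eq_smul (A k l), smul_smul]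

theorem pairing_uniform {η : C.EnergySpace M} (h : η ∈ C.uniformFields M)
    (θ : C.EnergySpace M') :
    pairing η θ = ∑ i, ∑ j, average (η.comp i j) * average (θ.comp i j) := by
  obtain ⟨A, hA, rfl⟩ := h
  refine Finset.sum_congr rfl fun i _ => Finset.sum_congr rfl fun j _ => ?_
  change (inner ℂ (C.toTorus (C.constField (A i j))) _).re = average (C.constField (A i j)) * _
  rw [average_constField, constField_eq_smul, map_smul, ← algebraMap_smul ℂ (A i j),
    inner_smul_left]
  simp only [Complex.coe_algebraMap, Complex.conj_ofReal, Complex.re_ofReal_mul]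
  rfl

theorem pairing_uniform_eq_zero {η : C.EnergySpace M} (h : η ∈ C.uniformFields M)
    {θ : C.EnergySpace M'} (hθ : ∀ i j, average (θ.comp i j) = 0) : pairing η θ = 0 := by
  rw [pairing_uniform h]
  simp only [hθ, mul_zero, Finset.sum_const_zero]

/-- A uniform tensor maps uniform fields to uniform fields, and these only see the average of `θ`.
It gives the orthogonality of `U_e` to `E₀` and of `U_s` to `S₀`, and the projector onto uniform
fields. -/
theorem inner_uniform_eq_zero {η θ : C.EnergySpace M} (h : η ∈ C.uniformFields M)
    (hθ : ∀ i j, average (θ.comp i j) = 0) : inner ℝ η θ = 0 := by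
  rw [inner_eq_pairing (M' := M)]
  exact pairing_uniform_eq_zero (applyTensor_mem_uniformFields M h) hθ

theorem isOrthogonalProjector_mean (C : PeriodicCell d) (M : ElasticityTensor d) :
    IsOrthogonalProjector (C.uniformFields M) fun η => η.mean :=
  isOrthogonalProjector_of_mem mean_mem fun η => (Submodule.mem_orthogonal _ _).2 fun _ hu =>
    inner_uniform_eq_zero hu (average_sub_mean η)

/-- Uniform fields have only the mode `k = 0`, where the wave vector is zero. -/
theorem isDivFree_uniform {η : C.EnergySpace M} (h : η ∈ C.uniformFields M) : C.IsDivFree η := by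
  obtain ⟨A, hA, rfl⟩ := h
  rw [isDivFree_iff]
  intro i k
  refine Finset.sum_eq_zero fun j _ => ?_
  change _ * (charBasis d).repr (C.toTorus (C.constField (A i j))) k = 0
  rw [toTorus_constField, map_smul, HilbertBasis.repr_self, lp.coeFn_smul, Pi.smul_apply,
    lp.single_apply]
  by_cases hk : k = 0
  · rw [← freq, hk, freq_zero, Complex.ofReal_zero, zero_mul]
  · simp [hk]

theorem isDivFree_add {s t : C.EnergySpace M} (hs : C.IsDivFree s) (ht : C.IsDivFree t) :
    C.IsDivFree (s + t) := by
  rw [isDivFree_iff] at *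
  intro i k
  have h := congrArg₂ (· + ·) (hs i k) (ht i k)
  simp only [← Finset.sum_add_distrib, ← mul_add, add_zero] at h
  simpa only [comp_add, map_add, lp.coeFn_add, Pi.add_apply] using h

theorem isDivFree_neg {s : C.EnergySpace M} (hs : C.IsDivFree s) : C.IsDivFree (-s) := by
  rw [isDivFree_iff] at *
  intro i k
  have h := congrArg Neg.neg (hs i k)
  have hc : ∀ j, (-s).comp i j = -s.comp i j := fun _ => rfl
  simp only [← Finset.sum_neg_distrib, ← mul_neg, neg_zero] at h
  simpa only [hc, map_neg, lp.coeFn_neg, Pi.neg_apply] using h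

theorem mem_selfEquilibratedFields_iff {s : C.EnergySpace M} :
    s ∈ C.selfEquilibratedFields M ↔ C.IsDivFree s ∧ ∀ i j, average (s.comp i j) = 0 := by
  simp only [← setAverage_val]
  rfl

/-- Subtracting the mean does not affect the divergence, so `S` consists of all divergence-free
fields. -/
theorem mem_uniform_sup_selfEquilibrated_iff {s : C.EnergySpace M} :
    s ∈ C.uniformFields M ⊔ C.selfEquilibratedFields M ↔ C.IsDivFree s := by
  refine ⟨fun h => ?_, fun h => ?_⟩
  · obtain ⟨u, hu, t, ht, rfl⟩ := Submodule.mem_sup.1 h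
    exact isDivFree_add (isDivFree_uniform hu) ht.1
  · refine Submodule.mem_sup.2 ⟨s.mean, mean_mem s, s - s.mean,
      mem_selfEquilibratedFields_iff.2 ⟨?_, average_sub_mean s⟩, add_sub_cancel _ _⟩
    rw [sub_eq_add_neg]
    exact isDivFree_add h (isDivFree_neg (isDivFree_uniform (mean_mem s)))

/-- The mean of `e` is uniform, hence divergence-free, and does no work on `e`. This work is the sum
of the squares of the averages of `e`. -/
theorem average_eq_zero_of_compatible {e : C.EnergySpace M} (he : e ∈ C.compatibleFields M)
    (i j : Fin d) : average (e.comp i j) = 0 := by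
  have h := pairing_eq_zero_of_isDivFree (isDivFree_uniform (mean_mem e)) he
  rw [pairing_uniform (mean_mem e)] at h
  simp only [average_mean] at h
  rw [Finset.sum_eq_zero_iff_of_nonneg
    fun _ _ => Finset.sum_nonneg fun _ _ => mul_self_nonneg _] at h
  have h2 := h i (Finset.mem_univ i)
  rw [Finset.sum_eq_zero_iff_of_nonneg fun _ _ => mul_self_nonneg _] at h2
  exact mul_self_eq_zero.1 (h2 j (Finset.mem_univ j))

end EnergySpace

/-! ### The decomposition of strains and the Green's operators. -/

open EnergySpace

variable {L : ElasticityTensor d}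

theorem stiffness_compliance (τ : C.StressSpace L) : C.stiffness L (C.compliance L τ) = τ := by
  refine ext_val ?_
  filter_upwards [val_applyTensor (M' := L.inv) L (C.compliance L τ),
    val_applyTensor (M' := L) L.inv τ] with x h1 h2
  exact h1.trans ((congrArg L.act h2).trans (L.act_inv_act _ (τ.val_symm x)))

theorem compliance_stiffness (η : C.StrainSpace L) : C.compliance L (C.stiffness L η) = η := by
  refine ext_val ?_
  filter_upwards [val_applyTensor (M' := L) L.inv (C.stiffness L η),
    val_applyTensor (M' := L.inv) L η] with x h1 h2
  exact h1.trans ((congrArg L.inv.act h2).trans (L.inv_act_act _ (η.val_symm x)))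

theorem stiffness_sub (η θ : C.StrainSpace L) :
    C.stiffness L (η - θ) = C.stiffness L η - C.stiffness L θ := applyTensor_sub _ _ _

theorem stiffness_add (η θ : C.StrainSpace L) :
    C.stiffness L (η + θ) = C.stiffness L η + C.stiffness L θ := applyTensor_add _ _ _

theorem compliance_sub (τ σ : C.StressSpace L) :
    C.compliance L (τ - σ) = C.compliance L τ - C.compliance L σ := applyTensor_sub _ _ _

theorem inner_strain (η θ : C.StrainSpace L) : inner ℝ η θ = pairing (C.stiffness L η) θ :=
  inner_eq_pairing _ _

theorem inner_stress (τ σ : C.StressSpace L) : inner ℝ τ σ = pairing τ (C.compliance L σ) := by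
  rw [real_inner_comm, inner_eq_pairing (M' := L), pairing_comm]
  rfl

theorem mem_admS_iff {s : C.StressSpace L} : s ∈ C.admS L ↔ C.IsDivFree s :=
  mem_uniform_sup_selfEquilibrated_iff

theorem mem_S0_iff {s : C.StressSpace L} :
    s ∈ C.S0 L ↔ C.IsDivFree s ∧ ∀ i j, average (s.comp i j) = 0 :=
  mem_selfEquilibratedFields_iff

/-- A strain field is orthogonal to the compatible fields if and only if the associated stress is
in equilibrium. -/
theorem mem_E0_orthogonal_iff {η : C.StrainSpace L} :
    η ∈ (C.E0 L)ᗮ ↔ C.IsDivFree (C.stiffness L η) := by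
  rw [Submodule.mem_orthogonal']
  simp only [inner_strain]
  exact ⟨isDivFree_of_pairing_eq_zero L, fun h e he => pairing_eq_zero_of_isDivFree h he⟩

/-- The zero average of `s` handles the uniform part of `e`, and its zero divergence the compatible
part. -/
theorem pairing_eq_zero_of_mem {s : C.StressSpace L} (hs : s ∈ C.S0 L) {e : C.StrainSpace L}
    (he : e ∈ C.admE L) : pairing s e = 0 := by
  obtain ⟨u, hu, f, hf, rfl⟩ := Submodule.mem_sup.1 he
  rw [mem_S0_iff] at hs
  rw [pairing_add_right, pairing_comm, pairing_uniform_eq_zero hu hs.2,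
    pairing_eq_zero_of_isDivFree hs.1 hf, add_zero]

/-- The Hodge-type decomposition of a strain field. -/
theorem exists_decomposition (η : C.StrainSpace L) : ∃ e ∈ C.E0 L, ∃ s ∈ C.S0 L,
    η = η.mean + e + C.compliance L s := by
  have : CompleteSpace (C.E0 L) :=
    (isClosed_compatibleFields (C := C) (M := L)).completeSpace_coe
  -- `e` is the projection of `η` onto `E₀`. As `η.mean` is also orthogonal to `E₀`, so is `η -
  -- η.mean - e`, whose stress is the required `s`.
  obtain ⟨e, he, hr⟩ := Submodule.HasOrthogonalProjection.exists_orthogonal (K := C.E0 L) η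
  have hm : η.mean ∈ (C.E0 L)ᗮ :=
    (Submodule.mem_orthogonal' _ _).2 fun f hf =>
      inner_uniform_eq_zero (mean_mem η) (average_eq_zero_of_compatible hf)
  have hr' : η - η.mean - e ∈ (C.E0 L)ᗮ := by
    have h := Submodule.sub_mem _ hr hm
    rwa [sub_right_comm] at h
  refine ⟨e, he, C.stiffness L (η - η.mean - e),
    mem_S0_iff.2 ⟨mem_E0_orthogonal_iff.1 hr', fun i j => ?_⟩, ?_⟩
  · rw [stiffness, average_applyTensor]
    refine Finset.sum_eq_zero fun k _ => Finset.sum_eq_zero fun l _ => ?_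
    rw [comp_sub, map_sub, average_sub_mean, average_eq_zero_of_compatible he, sub_zero, mul_zero]
  · rw [compliance_stiffness]
    abel

theorem mean_add_mem_admE (η : C.StrainSpace L) {e : C.StrainSpace L} (he : e ∈ C.E0 L) :
    η.mean + e ∈ C.admE L :=
  Submodule.add_mem_sup (mean_mem η) he

/-- The difference of two solutions lies in `E₀` and in its orthogonal complement. -/
theorem solvesStrain_unique {τ : C.StressSpace L} {e f : C.StrainSpace L}
    (he : C.SolvesStrain L τ e) (hf : C.SolvesStrain L τ f) : e = f := by
  have h1 : e - f ∈ (C.E0 L)ᗮ := by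
    rw [mem_E0_orthogonal_iff, stiffness_sub, ← mem_admS_iff]
    have h := Submodule.sub_mem _ he.2 hf.2
    rwa [sub_sub_sub_cancel_right] at h
  have h2 := (Submodule.mem_orthogonal _ _).1 h1 _ (Submodule.sub_mem _ he.1 hf.1)
  exact sub_eq_zero.1 (inner_self_eq_zero.1 h2)

/-- The difference lies in `S₀` and its image under `L₀⁻¹` in `E`, so their pairing, the energy of
the difference, is zero. -/
theorem solvesStress_unique {η : C.StrainSpace L} {s t : C.StressSpace L}
    (hs : C.SolvesStress L η s) (ht : C.SolvesStress L η t) : s = t := by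
  have h1 : C.compliance L (s - t) ∈ C.admE L := by
    rw [compliance_sub]
    have h := Submodule.sub_mem _ hs.2 ht.2
    rwa [sub_sub_sub_cancel_right] at h
  have h2 := pairing_eq_zero_of_mem (Submodule.sub_mem _ hs.1 ht.1) h1
  rw [← inner_stress] at h2
  exact sub_eq_zero.1 (inner_self_eq_zero.1 h2)

theorem solvesStrain_of_decomposition {η e : C.StrainSpace L} {s : C.StressSpace L}
    (he : e ∈ C.E0 L) (hs : s ∈ C.S0 L) (h : η = η.mean + e + C.compliance L s) :
    C.SolvesStrain L (C.stiffness L η) e := by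
  refine ⟨he, ?_⟩
  have h1 : C.stiffness L e - C.stiffness L η = -(C.stiffness L η.mean + s) := by
    conv_lhs => rw [h, stiffness_add, stiffness_add, stiffness_compliance]
    abel
  rw [h1]
  exact Submodule.neg_mem _
    (Submodule.add_mem_sup (applyTensor_mem_uniformFields L (mean_mem η)) hs)

theorem solvesStress_of_decomposition {η e : C.StrainSpace L} {s : C.StressSpace L}
    (he : e ∈ C.E0 L) (hs : s ∈ C.S0 L) (h : η = η.mean + e + C.compliance L s) :
    C.SolvesStress L η s := by
  refine ⟨hs, ?_⟩
  have h1 : C.compliance L s - η = -(η.mean + e) := by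
    rw [eq_neg_iff_add_eq_zero, sub_add_eq_add_sub, sub_eq_zero, add_comm]
    exact h.symm
  rw [h1]
  exact Submodule.neg_mem _ (mean_add_mem_admE η he)

/-- Every stress is `L₀` of a strain, so the decomposition of `L₀⁻¹ τ` contains the solution. -/
theorem existsUnique_solvesStrain (τ : C.StressSpace L) :
    ∃! e : C.StrainSpace L, C.SolvesStrain L τ e := by
  obtain ⟨e, he, s, hs, h⟩ := exists_decomposition (C.compliance L τ)
  have h1 := solvesStrain_of_decomposition he hs h
  rw [stiffness_compliance] at h1
  exact ⟨e, h1, fun f hf => solvesStrain_unique hf h1⟩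

theorem existsUnique_solvesStress (η : C.StrainSpace L) :
    ∃! s : C.StressSpace L, C.SolvesStress L η s := by
  obtain ⟨e, he, s, hs, h⟩ := exists_decomposition η
  have h1 := solvesStress_of_decomposition he hs h
  exact ⟨s, h1, fun f hf => solvesStress_unique hf h1⟩

theorem solvesStrain_Gamma0 (τ : C.StressSpace L) : C.SolvesStrain L τ (C.Gamma0 L τ) := by
  have h := (existsUnique_solvesStrain τ).exists
  rw [Gamma0, dif_pos h]
  exact h.choose_spec

theorem solvesStress_Delta0 (η : C.StrainSpace L) : C.SolvesStress L η (C.Delta0 L η) := by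
  have h := (existsUnique_solvesStress η).exists
  rw [Delta0, dif_pos h]
  exact h.choose_spec

theorem strain_decomposition (η : C.StrainSpace L) :
    η = η.mean + C.Gamma0 L (C.stiffness L η) + C.compliance L (C.Delta0 L η) := by
  obtain ⟨e, he, s, hs, h⟩ := exists_decomposition η
  rw [solvesStrain_unique (solvesStrain_Gamma0 _) (solvesStrain_of_decomposition he hs h),
    solvesStress_unique (solvesStress_Delta0 _) (solvesStress_of_decomposition he hs h)]
  exact h

theorem stress_decomposition (τ : C.StressSpace L) :
    τ = τ.mean + C.Delta0 L (C.compliance L τ) + C.stiffness L (C.Gamma0 L τ) := by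
  have h := congrArg (C.stiffness L) (strain_decomposition (C.compliance L τ))
  rw [stiffness_add, stiffness_add, stiffness_compliance, stiffness_compliance] at h
  have hm : C.stiffness L (C.compliance L τ).mean = τ.mean := by
    rw [stiffness, ← mean_applyTensor]
    exact congrArg mean (stiffness_compliance τ)
  rw [hm, add_right_comm] at h
  exact h

end PeriodicCell

/-! ### The proposition. -/

open PeriodicCell PeriodicCell.EnergySpace

theorem proposition2p1 {d : ℕ} (C : PeriodicCell d) (L : ElasticityTensor d) :
    -- the two spaces are Hilbert spaces, and the problems defining the Green's operators are
    -- uniquely solvable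
    (CompleteSpace (C.StrainSpace L) ∧ CompleteSpace (C.StressSpace L)) ∧
    (∀ τ : C.StressSpace L, ∃! e : C.StrainSpace L, C.SolvesStrain L τ e) ∧
    (∀ η : C.StrainSpace L, ∃! s : C.StressSpace L, C.SolvesStress L η s) ∧
    -- strain fields
    (C.Ue L ⟂ C.E0 L ∧
      IsOrthogonalProjector (C.Ue L) (fun η => η.mean) ∧
      IsOrthogonalProjector (C.E0 L) (fun η => C.Gamma0 L (C.stiffness L η)) ∧
      IsOrthogonalProjector (C.admE L)ᗮ (fun η => C.compliance L (C.Delta0 L η)) ∧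
      ∀ η : C.StrainSpace L,
        η = η.mean + C.Gamma0 L (C.stiffness L η) + C.compliance L (C.Delta0 L η)) ∧
    -- stress fields
    (C.Us L ⟂ C.S0 L ∧
      IsOrthogonalProjector (C.Us L) (fun τ => τ.mean) ∧
      IsOrthogonalProjector (C.S0 L) (fun τ => C.Delta0 L (C.compliance L τ)) ∧
      IsOrthogonalProjector (C.admS L)ᗮ (fun τ => C.stiffness L (C.Gamma0 L τ)) ∧
      ∀ τ : C.StressSpace L,
        τ = τ.mean + C.Delta0 L (C.compliance L τ) + C.stiffness L (C.Gamma0 L τ)) := by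
  refine ⟨⟨inferInstance, inferInstance⟩, existsUnique_solvesStrain, existsUnique_solvesStress,
    ⟨?_, isOrthogonalProjector_mean C L, ?_, ?_, strain_decomposition⟩,
    ⟨?_, isOrthogonalProjector_mean C L.inv, ?_, ?_, stress_decomposition⟩⟩
  · exact Submodule.isOrtho_iff_inner_eq.2 fun u hu e he =>
      inner_uniform_eq_zero hu (average_eq_zero_of_compatible he)
  · refine isOrthogonalProjector_of_mem (fun η => (solvesStrain_Gamma0 _).1) fun η => ?_
    -- Orthogonality of the residual to `E₀` is, up to sign, the equation defining `Γ₀`.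
    rw [mem_E0_orthogonal_iff, stiffness_sub, ← mem_admS_iff, ← neg_sub]
    exact Submodule.neg_mem _ (solvesStrain_Gamma0 _).2
  · refine isOrthogonalProjector_of_mem (fun η => ?_) fun η => ?_
    · rw [Submodule.mem_orthogonal']
      intro e he
      rw [inner_strain, stiffness_compliance]
      exact pairing_eq_zero_of_mem (solvesStress_Delta0 η).1 he
    -- The residual lies in `E` itself, hence in `Eᗮᗮ`; closedness of `E` is not needed.
    · refine Submodule.le_orthogonal_orthogonal _ ?_
      rw [← neg_sub]
      exact Submodule.neg_mem _ (solvesStress_Delta0 η).2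
  · exact Submodule.isOrtho_iff_inner_eq.2 fun u hu s hs =>
      inner_uniform_eq_zero hu (mem_S0_iff.1 hs).2
  · refine isOrthogonalProjector_of_mem (fun τ => (solvesStress_Delta0 _).1) fun τ => ?_
    rw [Submodule.mem_orthogonal]
    intro s hs
    rw [inner_stress, compliance_sub, ← neg_sub]
    exact pairing_eq_zero_of_mem hs (Submodule.neg_mem _ (solvesStress_Delta0 _).2)
  · refine isOrthogonalProjector_of_mem (fun τ => ?_) fun τ => ?_
    · rw [Submodule.mem_orthogonal]
      intro s hs
      rw [inner_stress, compliance_stiffness]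
      -- The energy product of `s` with `L₀ Γ₀ τ` is the work of `s` on the compatible strain `Γ₀
      -- τ`.
      exact pairing_eq_zero_of_isDivFree (mem_admS_iff.1 hs) (solvesStrain_Gamma0 τ).1
    · refine Submodule.le_orthogonal_orthogonal _ ?_
      rw [← neg_sub]
      exact Submodule.neg_mem _ (solvesStrain_Gamma0 τ).2
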